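/- Let $\mathcal H$ be a complex Hilbert space and $\mathbb P\mathcal H$ its projective space, with the transition probabilities $p(\rho,\sigma)=|\langle x,y\rangle|^2$ for unit vectors $x\in\rho$, $y\in\sigma$. For $A\in B(\mathcal H)_{\rm sa}$ let $\hat A(\rho)=\langle x,Ax\rangle$. Let $\mathfrak A_0$ be the closure in $\ell^\infty(\mathbb P\mathcal H)$ of the real span of the functions $p(\rho,\cdot)$, and regard $\mathfrak A(\mathbb P\mathcal H)=\mathfrak A_0^{**}$ as a space of functions on $\mathbb P\mathcal H$ by evaluation at the point functionals. Suppose that $\mathbb P\mathcal H$ is a Poisson space whose Poisson structure is symplectic. That is, $\mathbb P\mathcal H$ carries a Hausdorff topology, and there are a smooth Banach manifold $S$ with a (strongly nondegenerate, closed, smooth) symplectic form $\omega$, a continuous bijection $\iota:S\to\mathbb P\mathcal H$, and a linear space $\mathfrak A$ of continuous functions on $\mathbb P\mathcal H$ which separates points, consists of functions $f$ with $f\circ\iota$ smooth, and is closed under the Poisson bracket $\{f,g\}=X_fg$ of $S$, where $X_f$ is defined by $\omega(X_f,\cdot)=df$. Assume that the manifold structure of $S$ is one for which all functions $\hat A\circ\iota$,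 $A\in B(\mathcal H)_{\rm sa}$, are smooth (such as the usual manifold structure of $\mathbb P\mathcal H$). Assume further that - (weak density) $\mathfrak A=\{\hat A: A\in V\}$ for a real linear subspace $V$ of $B(\mathcal H)_{\rm sa}$ which is dense in $B(\mathcal H)_{\rm sa}$ for the weak operator topology; - (unitarity) for every continuous $h\in\mathfrak A(\mathbb P\mathcal H)$ with $h\circ\iota$ smooth, the Hamiltonian curves of $h$ satisfy $p(\rho(t),\sigma(t))=p(\rho(0),\sigma(0))$ for all $t$ for which both curves are defined. Then the Poisson structure is determined up to a real multiplicative constant, and is a real multiple of the Fubini–Study Poisson structure: there is $\hbar^{-1}\in\mathbb R$ such that 1. $\{\hat A,\hat B\}=\hbar^{-1}\, i\,\widehat{(AB-BA)}$ for all $A,B\in B(\mathcal H)_{\rm sa}$, in particular for all $\hat A,\hat B\in\mathfrak A$; 2. $\iota^*\omega_{FS}=\hbar^{-1}\omega$, where $\omega_{FS}(v,w)=2\,{\rm Im}\langle v,w\rangle$ for $v,w\in x^\perp\cong T_{[x]}\mathbb P\mathcal H$, $\|x\|=1$, is the Fubini–Study form (inner product linear in the second variable); 3. $\omega$ is the only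 symplectic form on $S$ whose Poisson bracket satisfies $\{\hat A,\hat B\}=\hbar^{-1}\, i\,\widehat{(AB-BA)}$ for all $A,B\in V$. -/

import Mathlib

open scoped Manifold ContDiff ENNReal LinearAlgebra.Projectivization

noncomputable section

namespace PoissonTP

/-! ### Symplectic manifolds -/

section Symplectic

variable (E : Type*) [NormedAddCommGroup E] [NormedSpace ℝ E]
  (S : Type*) [TopologicalSpace S] [ChartedSpace E S] [IsManifold 𝓘(ℝ, E) ∞ S]

/-- A symplectic form on a smooth manifold `S` modelled on a real Banach space `E`: a smooth
alternating bilinear form on the tangent spaces which is closed and (strongly) nondegenerate,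
so that every smooth function has a Hamiltonian vector field. -/
structure SymplecticForm where
  form : ∀ s : S, TangentSpace 𝓘(ℝ, E) s →L[ℝ] TangentSpace 𝓘(ℝ, E) s →L[ℝ] ℝ
  alternating : ∀ (s : S) (v : TangentSpace 𝓘(ℝ, E) s), form s v v = 0
  smooth : ContMDiff 𝓘(ℝ, E) (𝓘(ℝ, E).prod 𝓘(ℝ, E →L[ℝ] E →L[ℝ] ℝ)) ∞
    (fun s : S => Bundle.TotalSpace.mk' (E →L[ℝ] E →L[ℝ] ℝ)
      (E := fun s : S => TangentSpace 𝓘(ℝ, E) s →L[ℝ] TangentSpace 𝓘(ℝ, E) s →L[ℝ] ℝ)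
      s (form s))
  nondegenerate : ∀ s : S, Function.Bijective
    (fun v : TangentSpace 𝓘(ℝ, E) s => form s v)
  /-- In the chart around any point `x` one has
  `D_u Ω(v, w) + D_v Ω(w, u) + D_w Ω(u, v) = 0` for all constant vector fields `u, v, w`. -/
  closed : ∀ (x : S), ∀ y ∈ (extChartAt 𝓘(ℝ, E) x).target, ∀ u v w : E,
    let Ω : E → E → E → ℝ := fun a b z => form ((extChartAt 𝓘(ℝ, E) x).symm z)
      (mfderiv 𝓘(ℝ, E) 𝓘(ℝ, E) (extChartAt 𝓘(ℝ, E) x).symm z a)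
      (mfderiv 𝓘(ℝ, E) 𝓘(ℝ, E) (extChartAt 𝓘(ℝ, E) x).symm z b)
    fderiv ℝ (Ω v w) y u + fderiv ℝ (Ω w u) y v + fderiv ℝ (Ω u v) y w = 0

variable {E S}

/-- The differential of a real function at a point. -/
def differential (f : S → ℝ) (s : S) : TangentSpace 𝓘(ℝ, E) s →L[ℝ] ℝ :=
  mfderiv 𝓘(ℝ, E) 𝓘(ℝ, ℝ) f s

/-- The Hamiltonian vector field `X_f`, defined by `Ω(X_f, v) = df(v)`. -/
def SymplecticForm.hamVF (Ω : SymplecticForm E S) (f : S → ℝ) (s : S) :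
    TangentSpace 𝓘(ℝ, E) s :=
  (Equiv.ofBijective _ (Ω.nondegenerate s)).symm (differential f s)

/-- The Poisson bracket `{f, g} = X_f g`. -/
def SymplecticForm.bracket (Ω : SymplecticForm E S) (f g : S → ℝ) (s : S) : ℝ :=
  differential g s (Ω.hamVF f s)

end Symplectic

/-! ### Transition probability spaces and their observables -/

section Transition

variable {P : Type*} (p : P → P → ℝ)

/-- The finite real linear combinations of the functions `p(ρ, ·)`, inside `ℓ^∞(P)`. -/
def finiteObservables : Submodule ℝ (lp (fun _ : P => ℝ) ∞) :=
  Submodule.span ℝ {f | ∃ ρ : P, ∀ σ : P, f σ = p ρ σ}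

/-- The sup-norm closure of `finiteObservables`. -/
def closedObservables : Submodule ℝ (lp (fun _ : P => ℝ) ∞) :=
  (finiteObservables p).topologicalClosure

/-- Evaluation at a point, as a continuous functional. -/
def evalAt (σ : P) : StrongDual ℝ (closedObservables p) :=
  (lp.evalCLM ℝ (fun _ : P => ℝ) ∞ σ).comp (closedObservables p).subtypeL

/-- The bidual of `closedObservables`, viewed as a space of functions on `P` by evaluating its
elements at the point functionals. -/
def bidualObservables : Set (P → ℝ) :=
  {f | ∃ Φ : StrongDual ℝ (StrongDual ℝ (closedObservables p)), ∀ σ, f σ = Φ (evalAt p σ)}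

end Transition

/-! ### Poisson spaces whose Poisson structure is symplectic -/

section PoissonSpace

variable {E : Type*} [NormedAddCommGroup E] [NormedSpace ℝ E]
  {S : Type*} [TopologicalSpace S] [ChartedSpace E S] [IsManifold 𝓘(ℝ, E) ∞ S]
  {P : Type*} [TopologicalSpace P]

/-- The continuous functions on `P` that are smooth on the symplectic leaf `ι : S → P`. -/
def IsLeafSmooth (E : Type*) [NormedAddCommGroup E] [NormedSpace ℝ E] [ChartedSpace E S]
    (ι : S → P) (f : P → ℝ) : Prop :=
  Continuous f ∧ ContMDiff 𝓘(ℝ, E) 𝓘(ℝ, ℝ) ∞ (fun s => f (ι s))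

/-- `P`, with the function space `𝔄` and the single symplectic leaf `ι : S → P`, is a Poisson
space (so its Poisson structure is symplectic). -/
structure IsSymplecticPoissonSpace (Ω : SymplecticForm E S) (ι : S → P)
    (𝔄 : Submodule ℝ (P → ℝ)) : Prop where
  hausdorff : T2Space P
  continuous_leaf : Continuous ι
  bijective_leaf : Function.Bijective ι
  separates : ∀ ρ σ : P, ρ ≠ σ → ∃ f ∈ 𝔄, f ρ ≠ f σ
  leafSmooth : ∀ f ∈ 𝔄, IsLeafSmooth E ι f
  bracket_mem : ∀ f ∈ 𝔄, ∀ g ∈ 𝔄, ∃ h ∈ 𝔄, ∀ s,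
    h (ι s) = Ω.bracket (fun s => f (ι s)) (fun s => g (ι s)) s

/-- Unitarity: for every leafwise smooth `h` in the bidual observables, the Hamiltonian curves of
`h` preserve the transition probabilities, for all times at which both curves are defined. -/
def IsUnitary (Ω : SymplecticForm E S) (ι : S → P) (p : P → P → ℝ) : Prop :=
  ∀ h ∈ bidualObservables p, IsLeafSmooth E ι h →
    ∀ (γ η : ℝ → S) (a b : ℝ), a < 0 → 0 < b →
      IsMIntegralCurveOn (I := 𝓘(ℝ, E)) γ (Ω.hamVF fun s => h (ι s)) (Set.Ioo a b) →
      IsMIntegralCurveOn (I := 𝓘(ℝ, E)) η (Ω.hamVF fun s => h (ι s)) (Set.Ioo a b) →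
      ∀ t ∈ Set.Ioo a b, p (ι (γ t)) (ι (η t)) = p (ι (γ 0)) (ι (η 0))

end PoissonSpace

/-! ### Projective Hilbert space -/

section Hilbert

variable {H : Type*} [NormedAddCommGroup H] [InnerProductSpace ℂ H]

/-- The standard transition probability `|⟨x, y⟩|²` (`x`, `y` unit vectors) on `ℙ ℂ H`. -/
def transProb (ρ σ : ℙ ℂ H) : ℝ :=
  ‖inner ℂ ρ.rep σ.rep‖ ^ 2 / (‖ρ.rep‖ ^ 2 * ‖σ.rep‖ ^ 2)

/-- The expectation value `⟨x, A x⟩` (`x` a unit vector in the ray `ρ`). -/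
def gelfand (A : H →L[ℂ] H) (ρ : ℙ ℂ H) : ℝ :=
  (inner ℂ ρ.rep (A ρ.rep)).re / ‖ρ.rep‖ ^ 2

/-- The self-adjoint operator `i(AB - BA)`. -/
def iComm (A B : H →L[ℂ] H) : H →L[ℂ] H :=
  Complex.I • (A * B - B * A)

/-- The orthogonal projection of `x` onto the ray `ρ`. -/
def rayProj (ρ : ℙ ℂ H) (x : H) : H :=
  (inner ℂ ρ.rep x / (‖ρ.rep‖ : ℂ) ^ 2) • ρ.rep

/-- The functions `Â` for `A` in a real space `V` of bounded self-adjoint operators. -/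
def gelfandSpace [CompleteSpace H] (V : Submodule ℝ (selfAdjoint (H →L[ℂ] H))) :
    Submodule ℝ (ℙ ℂ H → ℝ) where
  carrier := {f | ∃ A ∈ V, f = gelfand (A : H →L[ℂ] H)}
  add_mem' := by
    rintro _ _ ⟨A, hA, rfl⟩ ⟨B, hB, rfl⟩
    refine ⟨A + B, V.add_mem hA hB, ?_⟩
    funext ρ
    simp [gelfand, add_div]
  zero_mem' := ⟨0, V.zero_mem, by funext ρ; simp [gelfand]⟩
  smul_mem' := by
    rintro c _ ⟨A, hA, rfl⟩
    refine ⟨c • A, V.smul_mem c hA, ?_⟩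
    funext ρ
    have h : inner ℂ ρ.rep (c • (A : H →L[ℂ] H) ρ.rep)
        = (c : ℂ) * inner ℂ ρ.rep ((A : H →L[ℂ] H) ρ.rep) := by
      rw [← Complex.coe_smul, inner_smul_right]
    simp [gelfand, h, mul_div_assoc]

/-- `V` is dense in the bounded self-adjoint operators for the weak operator topology. -/
def IsWeaklyDense [CompleteSpace H] (V : Submodule ℝ (selfAdjoint (H →L[ℂ] H))) : Prop :=
  ∀ A : selfAdjoint (H →L[ℂ] H),
    (ContinuousLinearMapWOT.ofCLM (A : H →L[ℂ] H) : H →WOT[ℂ] H) ∈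
      closure ((fun B : selfAdjoint (H →L[ℂ] H) =>
        (ContinuousLinearMapWOT.ofCLM (B : H →L[ℂ] H) : H →WOT[ℂ] H)) '' (V : Set _))

variable {E : Type*} [NormedAddCommGroup E] [NormedSpace ℝ E]
  {S : Type*} [TopologicalSpace S] [ChartedSpace E S]

/-- For `x` in the ray `ι s`, the derivative at `s` in direction `v` of `s' ↦ P_{s'} x`, where
`P_{s'}` is the projection onto the ray `ι s'`. For `x` a unit vector this is the representative
in `x^⊥` of the tangent vector of `ℙ ℂ H` that is the image of `v`. -/
def horizontalLift (E : Type*) [NormedAddCommGroup E] [NormedSpace ℝ E] [ChartedSpace E S]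
    (ι : S → ℙ ℂ H) (s : S) (v : TangentSpace 𝓘(ℝ, E) s) : H :=
  mfderiv 𝓘(ℝ, E) 𝓘(ℝ, H) (fun s' => rayProj (ι s') (ι s).rep) s v

/-- The pull-back to `S` of the Fubini-Study symplectic form of `ℙ ℂ H`, with the normalization
`Ω(v, w) = 2 Im ⟨v, w⟩` for tangent vectors `v, w ∈ x^⊥` at the ray of a unit vector `x`. -/
def fubiniStudy (ι : S → ℙ ℂ H) (s : S) (v w : TangentSpace 𝓘(ℝ, E) s) : ℝ :=
  2 * (inner ℂ (horizontalLift E ι s v) (horizontalLift E ι s w)).im / ‖(ι s).rep‖ ^ 2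

end Hilbert

end PoissonTP

end

/-! Let u be a unit vector in the ray ι s, and let L (`tangentLift`) be the derivative at s of s' ↦
P_{s'} u, where P_{s'} projects onto ι s'. It exists because weak C² regularity into a Hilbert space
forces strict differentiability. Since P_{s'} is a projection, L takes values in u^⊥ and dÂ(v) = 2
Re⟨Au, Lv⟩. Carrying the Poisson tensor along L gives a real-linear skew operator K (`hamLift`) on H
with {Â, B̂}(s) = 2 Re⟨Bu, K Au⟩. The theorem reduces to K = c·i on u^⊥ with c independent of s;
then ħ⁻¹ = -c.

Every Â lies in the bidual (compress A to finite-dimensional subspaces, then use weak-*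
compactness). Unitarity, differentiated at time 0 along two Hamiltonian curves of Â, therefore gives
an identity between two rays that is linear in A. It holds for A ∈ V, where Â is continuous, and
extends to all self-adjoint A by weak density. Rank-one A then show that K maps each w in u^⊥ into
ℂw, skewness leaves only ℝ·iw, and A = i[P_ρ, P_σ] identifies the constants at different rays.

The assertions on forms need L to be injective, which is not given because ι is only a continuous
bijection. If c ≠ 0, K yields a right inverse of L onto u^⊥, and the implicit function theorem turns
a nontrivial kernel into nontrivial fibres of ι. If c = 0, all Hamiltonian fields vanish, and
separation of points forces E = 0. -/

noncomputable section

namespace PoissonTP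

open Topology Filter

/-! ### Hamiltonian vector fields and their regularity -/

section Hamiltonian

variable {E : Type*} [NormedAddCommGroup E] [NormedSpace ℝ E]
  {S : Type*} [TopologicalSpace S] [ChartedSpace E S] [IsManifold 𝓘(ℝ, E) ∞ S]

theorem SymplecticForm.form_hamVF (Ω : SymplecticForm E S) (f : S → ℝ) (s : S) :
    Ω.form s (Ω.hamVF f s) = differential f s :=
  (Equiv.ofBijective _ (Ω.nondegenerate s)).apply_symm_apply _

theorem SymplecticForm.form_swap (Ω : SymplecticForm E S) (s : S)
    (v w : TangentSpace 𝓘(ℝ, E) s) : Ω.form s v w = - Ω.form s w v := by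
  have h := Ω.alternating s (v + w)
  simp only [map_add, add_apply, Ω.alternating] at h
  linarith

theorem SymplecticForm.form_injective (Ω : SymplecticForm E S) (s : S) :
    Function.Injective (Ω.form s) := (Ω.nondegenerate s).1

/-- The linear isomorphism `v ↦ Ω(v, ·)` of a tangent space with its dual. -/
def SymplecticForm.flat [CompleteSpace E] (Ω : SymplecticForm E S) (s : S) :
    E ≃L[ℝ] (E →L[ℝ] ℝ) :=
  ContinuousLinearEquiv.ofBijective (E := E) (F := E →L[ℝ] ℝ) (Ω.form s)
    (LinearMap.ker_eq_bot.2 (Ω.nondegenerate s).1)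
    (LinearMap.range_eq_top.2 (Ω.nondegenerate s).2)

-- In a trivialization X_f = W⁻¹ df, where W is the local expression of the form, and operator
-- inversion is smooth at invertible operators. C¹ regularity is what makes integral curves exist.
open Bundle ContinuousLinearMap in
theorem SymplecticForm.contMDiffAt_hamVF [CompleteSpace E] (Ω : SymplecticForm E S)
    {f : S → ℝ} (hf : ContMDiff 𝓘(ℝ, E) 𝓘(ℝ, ℝ) ∞ f) (s₀ : S) :
    ContMDiffAt 𝓘(ℝ, E) 𝓘(ℝ, E).tangent 1
      (fun s => (⟨s, Ω.hamVF f s⟩ : TangentBundle 𝓘(ℝ, E) S)) s₀ := by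
  have hone : IsManifold 𝓘(ℝ, E) 1 S := IsManifold.of_le (n := ∞) (by simp)
  have hΩ := ((contMDiffAt_hom_bundle _).1 (Ω.smooth s₀)).2
  have hdf := (hf s₀).mfderiv_const (m := ∞) (by simp)
  rw [contMDiffAt_section]
  set e := trivializationAt E (TangentSpace 𝓘(ℝ, E) : S → Type _) s₀ with he
  set W : S → E →L[ℝ] E →L[ℝ] ℝ := fun s => inCoordinates E (TangentSpace 𝓘(ℝ, E))
    (E →L[ℝ] ℝ) (fun s : S => TangentSpace 𝓘(ℝ, E) s →L[ℝ] ℝ) s₀ s s₀ s (Ω.form s) with hW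
  have hbase : e.baseSet ∈ 𝓝 s₀ :=
    e.open_baseSet.mem_nhds (FiberBundle.mem_baseSet_trivializationAt' s₀)
  have hWapp : ∀ s ∈ e.baseSet, ∀ v w, W s v w = Ω.form s (e.symm s v) (e.symm s w) := by
    intro s hs v w
    have := inCoordinates_apply_eq₂ (F₁ := E) (E₁ := (TangentSpace 𝓘(ℝ, E) : S → Type _))
      (F₂ := E) (E₂ := (TangentSpace 𝓘(ℝ, E) : S → Type _)) (F₃ := ℝ) (E₃ := Trivial S ℝ)
      (x₀ := s₀) (x := s) (ϕ := Ω.form s) (v := v) (w := w) hs hs (by simp)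
    simpa using this
  have hinv : ∀ s ∈ e.baseSet, (W s).IsInvertible := by
    intro s hs
    let T := e.continuousLinearEquivAt ℝ s hs
    refine ⟨(T.symm.trans (Ω.flat s)).trans (T.arrowCongr (ContinuousLinearEquiv.refl ℝ ℝ)), ?_⟩
    ext v w
    rw [hWapp s hs]
    simp [T]
    rfl
  have hcoord : ∀ s ∈ e.baseSet, (e ⟨s, Ω.hamVF f s⟩).2
      = (W s).inverse (inTangentCoordinates 𝓘(ℝ, E) 𝓘(ℝ, ℝ) id f
          (mfderiv 𝓘(ℝ, E) 𝓘(ℝ, ℝ) f) s₀ s) := by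
    intro s hs
    symm
    rw [(hinv s hs).inverse_apply_eq]
    ext w
    rw [hWapp s hs, e.symm_apply_apply_mk hs, Ω.form_hamVF]
    have hfs : ∀ t : ℝ, t ∈ (trivializationAt ℝ (TangentSpace 𝓘(ℝ, ℝ)) (f s₀)).baseSet := by
      simp [chartAt_self_eq]
    change inCoordinates E (TangentSpace 𝓘(ℝ, E)) ℝ (TangentSpace 𝓘(ℝ, ℝ)) s₀ s (f s₀) (f s)
      (mfderiv 𝓘(ℝ, E) 𝓘(ℝ, ℝ) f s) w = _
    rw [inCoordinates_eq hs (hfs _)]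
    simp
    rfl
  have hWs : ContMDiffAt 𝓘(ℝ, E) 𝓘(ℝ, E →L[ℝ] E →L[ℝ] ℝ) ∞ W s₀ := hΩ
  have hWi := ((hinv s₀ (mem_of_mem_nhds hbase)).contDiffAt_map_inverse
    (n := ∞)).contMDiffAt.comp s₀ hWs
  have := hWi.clm_apply hdf
  refine (this.of_le (by simp)).congr_of_eventuallyEq ?_
  filter_upwards [hbase] with s hs
  rw [hcoord s hs]
  rfl

end Hamiltonian

/-! ### Weak regularity implies strict differentiability -/

section WeakStrict

variable {E : Type*} [NormedAddCommGroup E] [NormedSpace ℝ E]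

theorem _root_.ContDiffAt.eventually_norm_sub_sub_le {g : E → ℝ} {z₀ : E}
    (hg : ContDiffAt ℝ 2 g z₀) :
    ∃ C : ℝ, ∀ᶠ p : E × E in 𝓝 (z₀, z₀), ‖g p.1 - g p.2 - fderiv ℝ g z₀ (p.1 - p.2)‖
      ≤ C * (‖p.1 - z₀‖ + ‖p.2 - z₀‖) * ‖p.1 - p.2‖ := by
  have h1 : ContDiffAt ℝ 1 (fderiv ℝ g) z₀ := hg.fderiv_right (by norm_num)
  obtain ⟨K, t, ht, hK⟩ := h1.exists_lipschitzOnWith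
  have h2 : ∀ᶠ z in 𝓝 z₀, DifferentiableAt ℝ g z :=
    (hg.eventually (by simp)).mono fun z hz => hz.differentiableAt (by simp)
  obtain ⟨r, hr, hball⟩ := Metric.mem_nhds_iff.1 (inter_mem ht h2)
  refine ⟨K, ?_⟩
  filter_upwards [prod_mem_nhds (Metric.ball_mem_nhds z₀ hr) (Metric.ball_mem_nhds z₀ hr)]
    with ⟨a, b⟩ ⟨ha, hb⟩
  simp only [mem_ball_iff_norm] at ha hb
  have hsub : Metric.closedBall z₀ (max ‖a - z₀‖ ‖b - z₀‖) ⊆ Metric.ball z₀ r :=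
    Metric.closedBall_subset_ball (max_lt ha hb)
  have key := (convex_closedBall z₀ (max ‖a - z₀‖ ‖b - z₀‖)).norm_image_sub_le_of_norm_fderiv_le'
    (𝕜 := ℝ) (f := g) (φ := fderiv ℝ g z₀) (C := K * max ‖a - z₀‖ ‖b - z₀‖) (x := b) (y := a)
    (fun z hz => (hball (hsub hz)).2)
    (fun z hz => by
      refine (hK.norm_sub_le (hball (hsub hz)).1 (mem_of_mem_nhds ht)).trans ?_
      gcongr
      exact mem_closedBall_iff_norm.1 hz)
    (by simp [← dist_eq_norm]) (by simp [← dist_eq_norm])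
  refine key.trans ?_
  gcongr
  exact max_le (by simp) (by simp)

variable {F : Type*} [NormedAddCommGroup F] [InnerProductSpace ℝ F] [CompleteSpace F]

/-- Difference quotients converge weakly, so by Banach–Steinhaus and Riesz their limit is a vector D
v; a second use of Banach–Steinhaus, over the normalized D v, bounds D. -/
theorem exists_weak_fderiv {f : E → F} {z₀ : E}
    (hf : ∀ y, DifferentiableAt ℝ (fun z => inner ℝ y (f z)) z₀) :
    ∃ D : E →L[ℝ] F, ∀ y v, inner ℝ y (D v) = fderiv ℝ (fun z => inner ℝ y (f z)) z₀ v := by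
  have h1 : ∀ v, ∃ w, ∀ y, inner ℝ y w = fderiv ℝ (fun z => inner ℝ y (f z)) z₀ v := by
    intro v
    let q : ℝ → F → ℝ := fun c => innerSL ℝ (c • (f (z₀ + c⁻¹ • v) - f z₀))
    have hq : Tendsto q atTop
        (𝓝 fun y => fderiv ℝ (fun z => inner ℝ y (f z)) z₀ v) := by
      rw [tendsto_pi_nhds]
      intro y
      refine ((hf y).hasFDerivAt.lim_real v).congr fun c => ?_
      simp only [q, innerSL_apply_apply, real_inner_comm y, inner_smul_right, inner_sub_right,
        smul_eq_mul]
    let B := continuousLinearMapOfTendsto (fun c => innerSL ℝ (c • (f (z₀ + c⁻¹ • v) - f z₀))) hq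
    refine ⟨(InnerProductSpace.toDual ℝ F).symm B, fun y => ?_⟩
    rw [real_inner_comm, InnerProductSpace.toDual_symm_apply]
    rfl
  choose D hD using h1
  let Dl : E →ₗ[ℝ] F :=
    { toFun := D
      map_add' := fun v w => ext_inner_left ℝ fun y => by simp [hD, inner_add_right]
      map_smul' := fun c w => ext_inner_left ℝ fun y => by simp [hD, inner_smul_right] }
  obtain ⟨C, hC⟩ := banach_steinhaus (g := fun v : E => innerSL ℝ (‖v‖⁻¹ • D v)) fun y => by
    refine ⟨‖fderiv ℝ (fun z => inner ℝ y (f z)) z₀‖, fun v => ?_⟩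
    rw [innerSL_apply_apply, real_inner_comm, inner_smul_right, hD, norm_mul, norm_inv, norm_norm]
    exact inv_mul_le_of_le_mul₀ (norm_nonneg _) (norm_nonneg _)
      ((ContinuousLinearMap.le_opNorm _ _).trans (mul_comm _ _).le)
  refine ⟨Dl.mkContinuousOfExistsBound ⟨C, fun v => ?_⟩, fun y v => hD v y⟩
  rcases eq_or_ne v 0 with rfl | hv
  · simp
  have h := hC v
  rw [innerSL_apply_norm, norm_smul, norm_inv, norm_norm,
    inv_mul_le_iff₀ (norm_pos_iff.2 hv), mul_comm] at h
  exact h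

/-- A map into a Hilbert space which is weakly twice continuously differentiable at a point is
strictly differentiable there. -/
theorem exists_hasStrictFDerivAt_of_inner {f : E → F} {z₀ : E}
    (hf : ∀ y, ContDiffAt ℝ 2 (fun z => inner ℝ y (f z)) z₀) :
    ∃ D : E →L[ℝ] F, HasStrictFDerivAt f D z₀ := by
  obtain ⟨D, hD⟩ := exists_weak_fderiv fun y => (hf y).differentiableAt (by simp)
  refine ⟨D, .of_isLittleO ?_⟩
  rw [Asymptotics.isLittleO_iff]
  intro ε hε
  by_contra hcon
  obtain ⟨p, hp, hpε⟩ := exists_seq_forall_of_frequently (not_eventually.1 hcon)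
  let m : ℕ → ℝ := fun n => (‖(p n).1 - z₀‖ + ‖(p n).2 - z₀‖) * ‖(p n).1 - (p n).2‖
  let r : ℕ → F := fun n => f (p n).1 - f (p n).2 - D ((p n).1 - (p n).2)
  -- Along a sequence violating strict differentiability, the remainder divided by its second-order
  -- bound `m` is weakly bounded, hence norm bounded; as `m` is o(‖a - b‖), this is a contradiction.
  obtain ⟨C, hC⟩ := banach_steinhaus (g := fun n => innerSL ℝ ((m n)⁻¹ • r n)) fun y => by
    obtain ⟨C, hC⟩ := (hf y).eventually_norm_sub_sub_le
    have hbdd : ∀ᶠ n in atTop, ‖innerSL ℝ ((m n)⁻¹ • r n) y‖ ≤ max C 0 := by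
      filter_upwards [hp.eventually hC] with n hn
      have hm0 : 0 ≤ m n := by positivity
      rw [innerSL_apply_apply, real_inner_comm, inner_smul_right, norm_mul, norm_inv,
        Real.norm_of_nonneg hm0]
      refine inv_mul_le_of_le_mul₀ hm0 (le_max_right _ _) ?_
      simp only [r, inner_sub_right, hD]
      refine hn.trans ?_
      rw [mul_assoc, mul_comm]
      exact mul_le_mul_of_nonneg_left (le_max_left _ _) hm0
    obtain ⟨B, hB⟩ := (isBoundedUnder_of_eventually_le hbdd).bddAbove_range
    exact ⟨B, fun n => hB ⟨n, rfl⟩⟩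
  have hm : Tendsto (fun n => C * (‖(p n).1 - z₀‖ + ‖(p n).2 - z₀‖)) atTop (𝓝 0) := by
    have h1 : Tendsto (fun q : E × E => C * (‖q.1 - z₀‖ + ‖q.2 - z₀‖)) (𝓝 (z₀, z₀)) (𝓝 0) := by
      have : Continuous fun q : E × E => C * (‖q.1 - z₀‖ + ‖q.2 - z₀‖) := by fun_prop
      simpa using this.tendsto (z₀, z₀)
    exact h1.comp hp
  obtain ⟨n, hn⟩ := (hm.eventually (gt_mem_nhds hε)).exists
  refine hpε n ?_
  change ‖r n‖ ≤ ε * ‖(p n).1 - (p n).2‖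
  have hmr : ‖r n‖ ≤ C * m n := by
    have h := hC n
    rcases (show 0 ≤ m n by positivity).eq_or_lt with h0 | h0
    · have : (p n).1 = (p n).2 := by
        rcases mul_eq_zero.1 h0.symm with h1 | h1
        · have h2 : ‖(p n).1 - z₀‖ = 0 := by
            linarith [norm_nonneg ((p n).1 - z₀), norm_nonneg ((p n).2 - z₀)]
          have h3 : ‖(p n).2 - z₀‖ = 0 := by linarith
          rw [sub_eq_zero.1 (norm_eq_zero.1 h2), sub_eq_zero.1 (norm_eq_zero.1 h3)]
        · exact sub_eq_zero.1 (norm_eq_zero.1 h1)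
      simp [r, this, m]
    · rwa [innerSL_apply_norm, norm_smul, norm_inv, Real.norm_of_nonneg h0.le,
        inv_mul_le_iff₀ h0, mul_comm] at h
  refine hmr.trans ?_
  simp only [m, ← mul_assoc]
  gcongr

end WeakStrict

open ContinuousLinearMap InnerProductSpace

/-! ### Unit representatives and rank-one observables -/

section Rays

variable {H : Type*} [NormedAddCommGroup H] [InnerProductSpace ℂ H]

/-- A unit vector in a ray. -/
def unitVec (ρ : ℙ ℂ H) : H := ((‖ρ.rep‖⁻¹ : ℝ) : ℂ) • ρ.rep

theorem norm_rep_pos (ρ : ℙ ℂ H) : 0 < ‖ρ.rep‖ := norm_pos_iff.2 ρ.rep_nonzero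

@[simp] theorem norm_unitVec (ρ : ℙ ℂ H) : ‖unitVec ρ‖ = 1 := by
  rw [unitVec, norm_smul, Complex.norm_real, norm_inv, norm_norm,
    inv_mul_cancel₀ (norm_rep_pos ρ).ne']

theorem rep_eq_smul_unitVec (ρ : ℙ ℂ H) : ρ.rep = (‖ρ.rep‖ : ℂ) • unitVec ρ := by
  have : (‖ρ.rep‖ : ℂ) ≠ 0 := by exact_mod_cast (norm_rep_pos ρ).ne'
  rw [unitVec, smul_smul, Complex.ofReal_inv, mul_inv_cancel₀ this, one_smul]

theorem inner_unitVec_self (ρ : ℙ ℂ H) : inner ℂ (unitVec ρ) (unitVec ρ) = 1 := by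
  rw [inner_self_eq_norm_sq_to_K, norm_unitVec]; simp

theorem rayProj_eq (ρ : ℙ ℂ H) (x : H) : rayProj ρ x = inner ℂ (unitVec ρ) x • unitVec ρ := by
  have : (‖ρ.rep‖ : ℂ) ≠ 0 := by exact_mod_cast (norm_rep_pos ρ).ne'
  simp only [rayProj, unitVec, inner_smul_left, smul_smul]
  congr 1
  simp
  field_simp

theorem transProb_eq (ρ σ : ℙ ℂ H) :
    transProb ρ σ = ‖inner ℂ (unitVec ρ) (unitVec σ)‖ ^ 2 := by
  simp only [transProb, unitVec, inner_smul_left, inner_smul_right, norm_mul]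
  simp
  field_simp

theorem gelfand_eq (A : H →L[ℂ] H) (ρ : ℙ ℂ H) :
    gelfand A ρ = (inner ℂ (unitVec ρ) (A (unitVec ρ))).re := by
  simp only [gelfand, unitVec, map_smul, inner_smul_left, inner_smul_right]
  rw [Complex.conj_ofReal, Complex.re_ofReal_mul, Complex.re_ofReal_mul]
  field_simp

theorem exists_eq_smul_unitVec {x : H} (hx : x ≠ 0) :
    ∃ (ρ : ℙ ℂ H) (c : ℂ), c ≠ 0 ∧ x = c • unitVec ρ := by
  obtain ⟨a, ha⟩ := Projectivization.exists_smul_eq_mk_rep ℂ x hx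
  refine ⟨Projectivization.mk ℂ x hx, (a⁻¹ : ℂˣ) * ‖(Projectivization.mk ℂ x hx).rep‖, ?_, ?_⟩
  · refine mul_ne_zero (Units.ne_zero _) ?_
    exact_mod_cast (norm_rep_pos _).ne'
  · rw [mul_smul, ← rep_eq_smul_unitVec, ← ha, ← Units.smul_def, inv_smul_smul]

theorem eq_of_unitVec_eq_smul {ρ σ : ℙ ℂ H} {c : ℂ} (h : unitVec ρ = c • unitVec σ) : ρ = σ := by
  rw [← ρ.mk_rep, ← σ.mk_rep, Projectivization.mk_eq_mk_iff']
  refine ⟨‖ρ.rep‖ * c * (‖σ.rep‖ : ℂ)⁻¹, ?_⟩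
  conv_rhs => rw [rep_eq_smul_unitVec ρ, h]
  rw [unitVec, smul_smul, smul_smul]
  simp [mul_assoc]

theorem eq_of_transProb_eq_one {ρ σ : ℙ ℂ H} (h : transProb ρ σ = 1) : ρ = σ := by
  rw [transProb_eq, pow_eq_one_iff_of_nonneg (norm_nonneg _) two_ne_zero] at h
  obtain ⟨c, -, hc⟩ := (norm_inner_eq_norm_iff (𝕜 := ℂ) (x := unitVec ρ) (y := unitVec σ)
    (norm_ne_zero_iff.1 (by simp)) (norm_ne_zero_iff.1 (by simp))).1 (by simpa using h)
  exact (eq_of_unitVec_eq_smul hc).symm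

theorem transProb_self (ρ : ℙ ℂ H) : transProb ρ ρ = 1 := by
  rw [transProb_eq, inner_unitVec_self]; simp

theorem gelfand_rankOne_unitVec (ρ σ : ℙ ℂ H) :
    gelfand (rankOne ℂ (unitVec ρ) (unitVec ρ)) σ = transProb ρ σ := by
  rw [gelfand_eq, transProb_eq, rankOne_apply, inner_smul_right, ← inner_conj_symm (unitVec σ),
    Complex.mul_conj, Complex.ofReal_re, Complex.normSq_eq_norm_sq]

/-- The symmetrization of the rank-one operator `z ↦ ⟨y, z⟩ x`. -/
def symRankOne (x y : H) : H →L[ℂ] H := ((1 / 2 : ℝ) : ℂ) • (rankOne ℂ x y + rankOne ℂ y x)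

/-- Weak matrix coefficients of ρ ↦ P_ρ x are expectation values, so smoothness of all Â makes s ↦
P_s x weakly smooth. -/
theorem gelfand_symRankOne (x y : H) (ρ : ℙ ℂ H) :
    gelfand (symRankOne x y) ρ = (inner ℂ y (rayProj ρ x)).re := by
  rw [gelfand_eq, rayProj_eq, inner_smul_right, symRankOne]
  simp only [smul_apply, add_apply, rankOne_apply, inner_smul_right, inner_add_right]
  have h1 := inner_conj_symm (𝕜 := ℂ) x (unitVec ρ)
  have h2 := inner_conj_symm (𝕜 := ℂ) (unitVec ρ) y
  rw [← h1, ← h2, Complex.re_ofReal_mul]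
  generalize inner ℂ y (unitVec ρ) = a
  generalize inner ℂ (unitVec ρ) x = b
  simp
  ring

variable [CompleteSpace H]

theorem isSelfAdjoint_rankOne_self (x : H) : IsSelfAdjoint (rankOne ℂ x x) :=
  adjoint_rankOne x x

theorem isSelfAdjoint_symRankOne (x y : H) : IsSelfAdjoint (symRankOne x y) := by
  rw [isSelfAdjoint_iff', symRankOne, map_smulₛₗ, map_add, adjoint_rankOne, adjoint_rankOne,
    add_comm, Complex.conj_ofReal]

end Rays

/-! ### Expectation values belong to the bidual -/

section Bidual

variable {H : Type*} [NormedAddCommGroup H] [InnerProductSpace ℂ H]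

theorem abs_gelfand_le (A : H →L[ℂ] H) (ρ : ℙ ℂ H) : ‖gelfand A ρ‖ ≤ ‖A‖ := by
  rw [gelfand_eq]
  refine (Complex.abs_re_le_norm _).trans ((norm_inner_le_norm _ _).trans ?_)
  simpa using A.le_opNorm (unitVec ρ)

/-- The expectation value function of a bounded operator, as a bounded function. -/
def gelfandLp (A : H →L[ℂ] H) : lp (fun _ : ℙ ℂ H => ℝ) ∞ :=
  ⟨gelfand A, memℓp_infty ⟨‖A‖, by rintro _ ⟨ρ, rfl⟩; exact abs_gelfand_le A ρ⟩⟩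

theorem gelfandLp_apply (A : H →L[ℂ] H) (ρ : ℙ ℂ H) : gelfandLp A ρ = gelfand A ρ := rfl

theorem norm_gelfandLp_le (A : H →L[ℂ] H) : ‖gelfandLp A‖ ≤ ‖A‖ :=
  lp.norm_le_of_forall_le (norm_nonneg _) (abs_gelfand_le A)

theorem gelfandLp_rankOne_mem (x : H) :
    gelfandLp (rankOne ℂ x x) ∈ finiteObservables (transProb (H := H)) := by
  rcases eq_or_ne x 0 with rfl | hx
  · convert Submodule.zero_mem _
    ext ρ
    simp [gelfandLp_apply, gelfand_eq]
  obtain ⟨ρ, c, -, rfl⟩ := exists_eq_smul_unitVec hx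
  have : gelfandLp (rankOne ℂ (c • unitVec ρ) (c • unitVec ρ))
      = ‖c‖ ^ 2 • gelfandLp (rankOne ℂ (unitVec ρ) (unitVec ρ)) := by
    ext σ
    simp only [lp.coeFn_smul, Pi.smul_apply, gelfandLp_apply, gelfand_eq, rankOne_apply,
      inner_smul_left, inner_smul_right, smul_eq_mul]
    rw [← Complex.re_ofReal_mul, Complex.ofReal_pow, ← Complex.conj_mul']
    congr 1
    ring
  rw [this]
  refine Submodule.smul_mem _ _ (Submodule.subset_span ⟨ρ, fun σ => ?_⟩)
  exact gelfand_rankOne_unitVec ρ σ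

theorem gelfandLp_symRankOne_mem (x y : H) :
    gelfandLp (symRankOne x y) ∈ finiteObservables (transProb (H := H)) := by
  have : gelfandLp (symRankOne x y) = (1 / 4 : ℝ) • (gelfandLp (rankOne ℂ (x + y) (x + y))
      - gelfandLp (rankOne ℂ (x - y) (x - y))) := by
    ext ρ
    simp only [lp.coeFn_smul, lp.coeFn_sub, Pi.smul_apply, Pi.sub_apply, gelfandLp_apply,
      gelfand_eq, symRankOne, smul_apply, add_apply, rankOne_apply, inner_smul_right,
      inner_add_right, inner_add_left, inner_sub_left, inner_sub_right, smul_eq_mul]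
    rw [Complex.re_ofReal_mul]
    simp only [Complex.add_re, Complex.mul_re, Complex.sub_re, Complex.add_im, Complex.sub_im]
    ring
  rw [this]
  exact Submodule.smul_mem _ _ (Submodule.sub_mem _ (gelfandLp_rankOne_mem _)
    (gelfandLp_rankOne_mem _))

theorem gelfand_compression (A : H →L[ℂ] H) (K : Submodule ℂ H) [K.HasOrthogonalProjection]
    (ρ : ℙ ℂ H) : gelfand (K.starProjection * A * K.starProjection) ρ
      = (inner ℂ (K.starProjection (unitVec ρ)) (A (K.starProjection (unitVec ρ)))).re := by
  rw [gelfand_eq, K.inner_starProjection_left_eq_right]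
  rfl

theorem gelfandLp_compression_mem (A : H →L[ℂ] H) (K : Submodule ℂ H) [FiniteDimensional ℂ K] :
    gelfandLp (K.starProjection * A * K.starProjection)
      ∈ finiteObservables (transProb (H := H)) := by
  let b := stdOrthonormalBasis ℂ K
  have hP : ∀ u : H, K.starProjection u = ∑ i, inner ℂ (b i : H) u • (b i : H) := by
    intro u
    rw [b.starProjection_eq_sum_rankOne, sum_apply]
    rfl
  have : gelfandLp (K.starProjection * A * K.starProjection)
      = ∑ i, ∑ j, gelfandLp (symRankOne (inner ℂ (b i : H) (A (b j)) • (b i : H)) (b j)) := by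
    ext ρ
    rw [lp.coeFn_sum, Finset.sum_apply]
    simp only [lp.coeFn_sum, Finset.sum_apply, gelfandLp_apply, gelfand_symRankOne, rayProj_eq]
    rw [gelfand_compression, hP]
    simp only [map_sum, map_smul, sum_inner, inner_sum, inner_smul_left, inner_smul_right,
      Complex.re_sum]
    rw [Finset.sum_comm]
    refine Finset.sum_congr rfl fun j _ => ?_
    rw [Finset.mul_sum, Complex.re_sum]
    refine Finset.sum_congr rfl fun i _ => ?_
    rw [inner_conj_symm]
    ring_nf
  rw [this]
  exact Submodule.sum_mem _ fun i _ => Submodule.sum_mem _ fun j _ => gelfandLp_symRankOne_mem _ _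

/-- Banach–Alaoglu: in a weak-* compact ball the closed conditions Φ (e i) = c i have the finite
intersection property. -/
theorem _root_.NormedSpace.exists_bidual_of_finset {X : Type*} [NormedAddCommGroup X]
    [NormedSpace ℝ X] {κ : Type*} (e : κ → StrongDual ℝ X) (c : κ → ℝ) (M : ℝ)
    (h : ∀ T : Finset κ, ∃ g : X, ‖g‖ ≤ M ∧ ∀ i ∈ T, e i g = c i) :
    ∃ Φ : StrongDual ℝ (StrongDual ℝ X), ∀ i, Φ (e i) = c i := by
  let C : κ → Set (WeakDual ℝ (StrongDual ℝ X)) := fun i => {Φ | Φ (e i) = c i}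
  have hne : (WeakDual.toStrongDual ⁻¹'
      Metric.closedBall (0 : StrongDual ℝ (StrongDual ℝ X)) M ∩ ⋂ i, C i).Nonempty := by
    refine (WeakDual.isCompact_closedBall _ _).inter_iInter_nonempty C (fun i => ?_) fun T => ?_
    · exact isClosed_singleton.preimage (WeakDual.eval_continuous (e i))
    · obtain ⟨g, hg, hgT⟩ := h T
      refine ⟨StrongDual.toWeakDual (NormedSpace.inclusionInDoubleDual ℝ X g), ?_, ?_⟩
      · simp only [Set.mem_preimage, mem_closedBall_zero_iff]
        exact (NormedSpace.double_dual_bound ℝ X g).trans hg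
      · exact Set.mem_iInter₂.2 hgT
  obtain ⟨Φ, -, hΦ⟩ := hne
  exact ⟨WeakDual.toStrongDual Φ, Set.mem_iInter.1 hΦ⟩

theorem gelfand_mem_bidualObservables (A : H →L[ℂ] H) :
    gelfand A ∈ bidualObservables (transProb (H := H)) := by
  obtain ⟨Φ, hΦ⟩ := NormedSpace.exists_bidual_of_finset (evalAt (transProb (H := H)))
    (gelfand A) ‖A‖ fun T => by
    -- Compression to the span of the rays in `T` keeps the expectation values on `T`, does not
    -- increase the norm, and has finite rank.
    let K : Submodule ℂ H := Submodule.span ℂ (unitVec '' (T : Set (ℙ ℂ H)))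
    have : FiniteDimensional ℂ K := FiniteDimensional.span_of_finite ℂ (T.finite_toSet.image _)
    let B := K.starProjection * A * K.starProjection
    refine ⟨⟨gelfandLp B, Submodule.le_topologicalClosure _ (gelfandLp_compression_mem A K)⟩,
      ?_, fun σ hσ => ?_⟩
    · refine (norm_gelfandLp_le B).trans ((norm_mul_le _ _).trans ?_)
      refine (mul_le_of_le_one_right (norm_nonneg _) K.starProjection_norm_le).trans ?_
      exact (norm_mul_le _ _).trans
        (mul_le_of_le_one_left (norm_nonneg _) K.starProjection_norm_le)
    · have hmem : unitVec σ ∈ K := Submodule.subset_span ⟨σ, hσ, rfl⟩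
      change gelfand B σ = gelfand A σ
      rw [gelfand_compression, gelfand_eq, K.starProjection_eq_self_iff.2 hmem]
  exact ⟨Φ, fun σ => (hΦ σ).symm⟩

end Bidual

/-! ### Infinitesimally unitary families of skew operators -/

section Core

variable {H : Type*} [NormedAddCommGroup H] [InnerProductSpace ℂ H]

theorem _root_.LinearMap.exists_eq_smul_of_forall_mem {M N : Type*} [AddCommGroup M] [Module ℝ M]
    [AddCommGroup N] [Module ℝ N] (j : M →ₗ[ℝ] N) (hj : Function.Injective j) (k : M →ₗ[ℝ] N)
    (W : Submodule ℝ M) (h : ∀ w ∈ W, ∃ t : ℝ, k w = t • j w) :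
    ∃ c : ℝ, ∀ w ∈ W, k w = c • j w := by
  by_cases hW : ∃ w₀ ∈ W, w₀ ≠ 0
  · obtain ⟨w₀, hw₀, hne⟩ := hW
    obtain ⟨c, hc⟩ := h w₀ hw₀
    refine ⟨c, fun w hw => ?_⟩
    obtain ⟨t, ht⟩ := h w hw
    obtain ⟨r, hr⟩ := h (w + w₀) (W.add_mem hw hw₀)
    have h1 : (r - t) • w = (c - r) • w₀ := by
      apply hj
      rw [map_add, map_add, hc, ht] at hr
      rw [smul_add] at hr
      simp only [sub_smul, map_sub, map_smul]
      rw [sub_eq_sub_iff_add_eq_add, ← hr, add_comm]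
    by_cases hrt : r - t = 0
    · rw [hrt, zero_smul] at h1
      have := (smul_eq_zero.1 h1.symm).resolve_right hne
      rw [ht]
      congr 1
      linarith
    · have : w = ((r - t)⁻¹ * (c - r)) • w₀ := by
        rw [mul_smul, ← h1, inv_smul_smul₀ hrt]
      rw [this, map_smul, map_smul, hc, smul_comm]
  · push Not at hW
    exact ⟨0, fun w hw => by simp [hW w hw]⟩

/-- The range of k ρ is orthogonal to the ray, so by skewness the ray lies in the kernel. -/
theorem skew_apply_smul_unitVec {k : ℙ ℂ H → H →ₗ[ℝ] H}
    (hperp : ∀ ρ w, inner ℂ (unitVec ρ) (k ρ w) = 0)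
    (hskew : ∀ ρ w w', (inner ℂ w' (k ρ w)).re = -(inner ℂ w (k ρ w')).re)
    (ρ : ℙ ℂ H) (c : ℂ) : k ρ (c • unitVec ρ) = 0 := by
  have h := hskew ρ (c • unitVec ρ) (k ρ (c • unitVec ρ))
  rw [inner_smul_left, hperp, mul_zero, Complex.zero_re, neg_zero] at h
  exact (inner_self_eq_zero (𝕜 := ℂ)).1
    (Complex.ext h (by simpa using inner_self_im (𝕜 := ℂ) (k ρ (c • unitVec ρ))))

theorem transProb_eq_of_eq_smul (ρ : ℙ ℂ H) {τ : ℙ ℂ H} {v : H} {d : ℂ} (hd : d ≠ 0)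
    (h : v = d • unitVec τ) :
    transProb ρ τ = ‖inner ℂ (unitVec ρ) v‖ ^ 2 / ‖v‖ ^ 2 := by
  rw [h, transProb_eq, inner_smul_right, norm_mul, norm_smul, norm_unitVec, mul_one, mul_pow,
    mul_div_cancel_left₀ _ (by simpa using hd)]

variable [CompleteSpace H]

/-- The infinitesimal form of the invariance of transition probabilities. -/
def IsInfinitesimallyUnitary (k : ℙ ℂ H → H →ₗ[ℝ] H) : Prop :=
  ∀ A : H →L[ℂ] H, IsSelfAdjoint A → ∀ ρ σ : ℙ ℂ H,
    (inner ℂ (inner ℂ (unitVec σ) (unitVec ρ) • unitVec σ) (k ρ (A (unitVec ρ)))).re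
      + (inner ℂ (inner ℂ (unitVec ρ) (unitVec σ) • unitVec ρ) (k σ (A (unitVec σ)))).re = 0

/-- Taking σ to be the ray of y kills the second term of the identity and isolates k ρ. -/
theorem IsInfinitesimallyUnitary.inner_of_apply_eq_zero {k : ℙ ℂ H → H →ₗ[ℝ] H}
    (hk : IsInfinitesimallyUnitary k) {A : H →L[ℂ] H} (hA : IsSelfAdjoint A) (ρ : ℙ ℂ H) {y : H}
    (hy : A y = 0) : (inner ℂ (inner ℂ y (unitVec ρ) • y) (k ρ (A (unitVec ρ)))).re = 0 := by
  rcases eq_or_ne y 0 with rfl | hne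
  · simp
  obtain ⟨σ, c, hc, rfl⟩ := exists_eq_smul_unitVec hne
  have hσ : A (unitVec σ) = 0 := by simpa [hc] using hy
  have h := hk A hA ρ σ
  rw [hσ, map_zero, inner_zero_right, Complex.zero_re, add_zero, inner_smul_left] at h
  rw [inner_smul_left, inner_smul_left, inner_smul_left, map_mul, Complex.conj_conj]
  have : c * (starRingEnd ℂ) (inner ℂ (unitVec σ) (unitVec ρ)) *
      ((starRingEnd ℂ) c * inner ℂ (unitVec σ) (k ρ (A (unitVec ρ))))
      = ((‖c‖ ^ 2 : ℝ) : ℂ) * ((starRingEnd ℂ) (inner ℂ (unitVec σ) (unitVec ρ)) *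
        inner ℂ (unitVec σ) (k ρ (A (unitVec ρ)))) := by
    rw [Complex.ofReal_pow, ← Complex.mul_conj']
    ring
  rw [this, Complex.re_ofReal_mul, h, mul_zero]

theorem IsInfinitesimallyUnitary.inner_eq_zero {k : ℙ ℂ H → H →ₗ[ℝ] H}
    (hk : IsInfinitesimallyUnitary k)
    (hperp : ∀ ρ w, inner ℂ (unitVec ρ) (k ρ w) = 0)
    (hskew : ∀ ρ w w', (inner ℂ w' (k ρ w)).re = -(inner ℂ w (k ρ w')).re)
    (ρ : ℙ ℂ H) {w w' : H} (hw : inner ℂ (unitVec ρ) w = 0) (hw' : inner ℂ (unitVec ρ) w' = 0)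
    (h : inner ℂ w w' = 0) : (inner ℂ w' (k ρ w)).re = 0 := by
  set x := unitVec ρ with hx
  have hxx : inner ℂ x x = 1 := inner_unitVec_self ρ
  have hnx : ‖x‖ = 1 := norm_unitVec ρ
  have hwx : inner ℂ w x = 0 := by rw [← inner_conj_symm, hw, map_zero]
  have hw'x : inner ℂ w' x = 0 := by rw [← inner_conj_symm, hw', map_zero]
  rcases eq_or_ne w 0 with rfl | hne
  · simp
  have hww : inner ℂ w w = (‖w‖ : ℂ) ^ 2 := inner_self_eq_norm_sq_to_K w
  let A : H →L[ℂ] H := rankOne ℂ (x + w) (x + w)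
  have hA : IsSelfAdjoint A := isSelfAdjoint_rankOne_self _
  -- Both `z` and `z + w'` are orthogonal to x + w, hence killed by A. They have the same inner
  -- product ‖w‖² with x, so subtracting the two identities leaves ‖w‖² Re⟨w', k w⟩ = 0.
  let z : H := (‖w‖ : ℂ) ^ 2 • x - w
  have hAx : A x = x + w := by simp [A, hnx, hwx]
  have hAz : A z = 0 := by
    have : inner ℂ (x + w) z = 0 := by
      simp only [z, inner_add_left, inner_sub_right, inner_smul_right, hxx, hwx, hw, hww]
      ring
    rw [rankOne_apply, this, zero_smul]
  have hAw' : A w' = 0 := by simp [A, hw', h]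
  have hkx : k ρ (A x) = k ρ w := by
    have := skew_apply_smul_unitVec hperp hskew ρ 1
    rw [one_smul] at this
    rw [hAx, map_add, this, zero_add]
  have h1 := hk.inner_of_apply_eq_zero hA ρ hAz
  have h2 := hk.inner_of_apply_eq_zero hA ρ (y := z + w') (by rw [map_add, hAz, hAw', add_zero])
  have hzx : inner ℂ z x = (‖w‖ : ℂ) ^ 2 := by
    simp [z, hnx, hwx]
  rw [← hx] at h1 h2
  rw [hkx, hzx] at h1
  rw [hkx, inner_add_left, hzx, hw'x, add_zero, smul_add, inner_add_left, Complex.add_re, h1,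
    zero_add, inner_smul_left, map_pow, Complex.conj_ofReal, ← Complex.ofReal_pow,
    Complex.re_ofReal_mul] at h2
  have : ‖w‖ ^ 2 ≠ 0 := by positivity
  exact (mul_eq_zero.1 h2).resolve_left this

theorem IsInfinitesimallyUnitary.exists_eq_smul {k : ℙ ℂ H → H →ₗ[ℝ] H}
    (hk : IsInfinitesimallyUnitary k)
    (hperp : ∀ ρ w, inner ℂ (unitVec ρ) (k ρ w) = 0)
    (hskew : ∀ ρ w w', (inner ℂ w' (k ρ w)).re = -(inner ℂ w (k ρ w')).re)
    (ρ : ℙ ℂ H) : ∃ c : ℝ, ∀ w, inner ℂ (unitVec ρ) w = 0 → k ρ w = c • Complex.I • w := by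
  let j : H →ₗ[ℝ] H := (LinearMap.lsmul ℂ H Complex.I).restrictScalars ℝ
  have hj : Function.Injective j := fun a b hab => smul_right_injective H Complex.I_ne_zero hab
  obtain ⟨c, hc⟩ := LinearMap.exists_eq_smul_of_forall_mem j hj (k ρ)
    ((ℂ ∙ unitVec ρ)ᗮ.restrictScalars ℝ) fun w hw => by
    have hw := Submodule.mem_orthogonal_singleton_iff_inner_right.1 hw
    rcases eq_or_ne w 0 with rfl | hne
    · exact ⟨0, by simp⟩
    have hww : inner ℂ w w = (‖w‖ : ℂ) ^ 2 := inner_self_eq_norm_sq_to_K w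
    have hn : (‖w‖ : ℂ) ^ 2 ≠ 0 := by simpa using hne
    set a : ℂ := inner ℂ w (k ρ w) / (‖w‖ : ℂ) ^ 2 with ha
    have hre : (inner ℂ w (k ρ w)).re = 0 := by linarith [hskew ρ w w]
    -- The component of k w orthogonal to w must vanish, since Re⟨d, k w⟩ = ‖d‖²; so k w = a w, and
    -- skewness makes a imaginary.
    let d := k ρ w - a • w
    have hwd : inner ℂ w d = 0 := by
      rw [inner_sub_right, inner_smul_right, hww, ha, div_mul_cancel₀ _ hn, sub_self]
    have hd : inner ℂ (unitVec ρ) d = 0 := by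
      rw [inner_sub_right, inner_smul_right, hw, hperp, mul_zero, sub_self]
    have hdk := hk.inner_eq_zero hperp hskew ρ hw hd hwd
    have hdw : inner ℂ d w = 0 := by rw [← inner_conj_symm, hwd, map_zero]
    have hdd : d = 0 := by
      rw [← inner_self_eq_zero (𝕜 := ℂ)]
      refine Complex.ext ?_ (by simpa using inner_self_im (𝕜 := ℂ) d)
      have : inner ℂ d d = inner ℂ d (k ρ w) := by
        conv_lhs => rw [inner_sub_right, inner_smul_right, hdw, mul_zero, sub_zero]
      rw [this, hdk, Complex.zero_re]
    refine ⟨a.im, ?_⟩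
    have hare : a.re = 0 := by
      rw [ha, ← Complex.ofReal_pow, Complex.div_ofReal_re, hre, zero_div]
    have hI : a = (a.im : ℂ) * Complex.I := Complex.ext (by simp [hare]) (by simp)
    have : k ρ w = a • w := sub_eq_zero.1 hdd
    rw [this]
    conv_lhs => rw [hI, mul_smul]
    exact Complex.coe_smul _ _
  exact ⟨c, fun w hw => hc w (Submodule.mem_orthogonal_singleton_iff_inner_right.2 hw)⟩

theorem isSelfAdjoint_iComm {A B : H →L[ℂ] H} (hA : IsSelfAdjoint A) (hB : IsSelfAdjoint B) :
    IsSelfAdjoint (iComm A B) := by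
  rw [isSelfAdjoint_iff, iComm, star_smul, star_sub, star_mul, star_mul, hA.star_eq, hB.star_eq]
  simp [← smul_neg]

/-- Testing on A = i[P_ρ, P_σ] turns the identity into (c - c') p (1 - p) = 0 with p = p(ρ, σ). -/
theorem eq_of_transProb_ne {ρ σ : ℙ ℂ H} (h0 : transProb ρ σ ≠ 0) (h1 : transProb ρ σ ≠ 1)
    {k : ℙ ℂ H → H →ₗ[ℝ] H} (hk : IsInfinitesimallyUnitary k) {c c' : ℝ}
    (hc : ∀ w, inner ℂ (unitVec ρ) w = 0 → k ρ w = c • Complex.I • w)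
    (hc' : ∀ w, inner ℂ (unitVec σ) w = 0 → k σ w = c' • Complex.I • w) : c = c' := by
  set x := unitVec ρ with hx
  set y := unitVec σ with hy
  have hxx : inner ℂ x x = 1 := inner_unitVec_self ρ
  have hyy : inner ℂ y y = 1 := inner_unitVec_self σ
  have hnx : ‖x‖ = 1 := norm_unitVec ρ
  have hny : ‖y‖ = 1 := norm_unitVec σ
  have hxy : (starRingEnd ℂ) (inner ℂ x y) = inner ℂ y x := inner_conj_symm _ _
  have hyx : (starRingEnd ℂ) (inner ℂ y x) = inner ℂ x y := inner_conj_symm _ _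
  have hp : inner ℂ x y * inner ℂ y x = (transProb ρ σ : ℂ) := by
    rw [transProb_eq, ← hxy, Complex.mul_conj', Complex.ofReal_pow]
  set p := transProb ρ σ
  have h := hk _ (isSelfAdjoint_iComm (isSelfAdjoint_rankOne_self x)
    (isSelfAdjoint_rankOne_self y)) ρ σ
  have hAx : iComm (rankOne ℂ x x) (rankOne ℂ y y) x
      = Complex.I • ((p : ℂ) • x - inner ℂ y x • y) := by
    simp [iComm, hnx, smul_smul, ← hp, mul_comm]
  have hAy : iComm (rankOne ℂ x x) (rankOne ℂ y y) y
      = Complex.I • (inner ℂ x y • x - (p : ℂ) • y) := by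
    simp [iComm, hny, smul_smul, ← hp]
  rw [← hx, ← hy, hAx, hAy, hc _ (by simp [hnx, ← hp, mul_comm]),
    hc' _ (by simp [hny, ← hp])] at h
  simp only [smul_smul, ← Complex.coe_smul, inner_smul_left, inner_smul_right, inner_sub_right,
    hxy, hyx, hxx, hyy] at h
  rw [mul_one, mul_one, mul_comm (inner ℂ y x) (inner ℂ x y), hp, Complex.I_mul_I] at h
  have e : ((c : ℂ) * -1 * (p * p - p)).re + ((c' : ℂ) * -1 * (p - p * p)).re
      = (c - c') * (p * (1 - p)) := by
    rw [← Complex.ofReal_re ((c - c') * (p * (1 - p))), ← Complex.add_re]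
    congr 1
    push_cast
    ring
  rw [e] at h
  have hpp : p * (1 - p) ≠ 0 := mul_ne_zero h0 (sub_ne_zero.2 h1.symm)
  exact sub_eq_zero.1 ((mul_eq_zero.1 h).resolve_right hpp)

/-- An infinitesimally unitary family of skew tensors on the orthogonal complements of the rays is
a constant multiple of the complex structure. -/
theorem IsInfinitesimallyUnitary.exists_forall_eq_smul {k : ℙ ℂ H → H →ₗ[ℝ] H}
    (hk : IsInfinitesimallyUnitary k)
    (hperp : ∀ ρ w, inner ℂ (unitVec ρ) (k ρ w) = 0)
    (hskew : ∀ ρ w w', (inner ℂ w' (k ρ w)).re = -(inner ℂ w (k ρ w')).re) :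
    ∃ c : ℝ, ∀ ρ w, inner ℂ (unitVec ρ) w = 0 → k ρ w = c • Complex.I • w := by
  choose c hc using hk.exists_eq_smul hperp hskew
  rcases isEmpty_or_nonempty (ℙ ℂ H) with hE | ⟨⟨ρ₀⟩⟩
  · exact ⟨0, fun ρ => hE.elim ρ⟩
  refine ⟨c ρ₀, fun ρ => ?_⟩
  suffices h : c ρ = c ρ₀ from h ▸ hc ρ
  by_cases h1 : transProb ρ ρ₀ = 1
  · rw [eq_of_transProb_eq_one h1]
  by_cases h0 : transProb ρ ρ₀ = 0
  · have hxy : inner ℂ (unitVec ρ) (unitVec ρ₀) = 0 := by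
      rwa [transProb_eq, sq_eq_zero_iff, norm_eq_zero] at h0
    have hyx : inner ℂ (unitVec ρ₀) (unitVec ρ) = 0 := by rw [← inner_conj_symm, hxy, map_zero]
    have hn : ‖unitVec ρ + unitVec ρ₀‖ ^ 2 = 2 := by
      have := norm_add_sq (𝕜 := ℂ) (unitVec ρ) (unitVec ρ₀)
      rw [this, hxy]
      norm_num
    -- Orthogonal rays are compared through the ray of the sum, at transition probability 1/2 from
    -- each.
    obtain ⟨τ, d, hd0, hd⟩ := exists_eq_smul_unitVec (x := unitVec ρ + unitVec ρ₀)
      (fun h => by simp [h] at hn)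
    have h2 : transProb ρ τ = 1 / 2 := by
      rw [← hn, transProb_eq_of_eq_smul ρ hd0 hd, inner_add_right, hxy, inner_unitVec_self]
      simp
    have h3 : transProb ρ₀ τ = 1 / 2 := by
      rw [← hn, transProb_eq_of_eq_smul ρ₀ hd0 hd, inner_add_right, hyx, inner_unitVec_self]
      simp
    exact (eq_of_transProb_ne (by rw [h2]; norm_num) (by rw [h2]; norm_num) hk (hc ρ) (hc τ)).trans
      (eq_of_transProb_ne (by rw [h3]; norm_num) (by rw [h3]; norm_num) hk (hc ρ₀) (hc τ)).symm
  · exact eq_of_transProb_ne h0 h1 hk (hc ρ) (hc ρ₀)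

end Core

/-! ### Derivatives read in charts and along curves -/

section Chart

variable {E : Type*} [NormedAddCommGroup E] [NormedSpace ℝ E]
  {S : Type*} [TopologicalSpace S] [ChartedSpace E S]
  {F : Type*} [NormedAddCommGroup F] [NormedSpace ℝ F]

theorem hasMFDerivAt_of_hasFDerivAt_comp_symm {f : S → F} {s : S} {D : E →L[ℝ] F}
    (h : HasFDerivAt (fun z => f ((extChartAt 𝓘(ℝ, E) s).symm z)) D (extChartAt 𝓘(ℝ, E) s s)) :
    HasMFDerivAt 𝓘(ℝ, E) 𝓘(ℝ, F) f s D := by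
  refine ⟨?_, ?_⟩
  · have h1 : ContinuousAt (fun s' => f ((extChartAt 𝓘(ℝ, E) s).symm (extChartAt 𝓘(ℝ, E) s s'))) s :=
      ContinuousAt.comp (f := extChartAt 𝓘(ℝ, E) s) h.continuousAt (continuousAt_extChartAt s)
    refine h1.congr ?_
    filter_upwards [extChartAt_source_mem_nhds (I := 𝓘(ℝ, E)) s] with s' hs'
    rw [(extChartAt 𝓘(ℝ, E) s).left_inv hs']
  · exact h.hasFDerivWithinAt

theorem hasFDerivAt_comp_symm_of_hasMFDerivAt {f : S → F} {s : S} {D : E →L[ℝ] F}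
    (h : HasMFDerivAt 𝓘(ℝ, E) 𝓘(ℝ, F) f s D) :
    HasFDerivAt (fun z => f ((extChartAt 𝓘(ℝ, E) s).symm z)) D (extChartAt 𝓘(ℝ, E) s s) := by
  have := h.2
  simp only [mfld_simps] at this
  exact this.hasFDerivAt Filter.univ_mem

theorem contDiffAt_comp_extChartAt_symm [IsManifold 𝓘(ℝ, E) ∞ S] {f : S → F}
    (hf : ContMDiff 𝓘(ℝ, E) 𝓘(ℝ, F) ∞ f) (s : S) :
    ContDiffAt ℝ ∞ (fun z => f ((extChartAt 𝓘(ℝ, E) s).symm z)) (extChartAt 𝓘(ℝ, E) s s) := by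
  have h := (contMDiffAt_iff.1 (hf s)).2
  simp only [mfld_simps] at h
  exact h.contDiffAt Filter.univ_mem

theorem hasDerivAt_comp_of_hasMFDerivAt {f : S → ℝ} {γ : ℝ → S} {t : ℝ} {v : E}
    (hf : MDifferentiableAt 𝓘(ℝ, E) 𝓘(ℝ, ℝ) f (γ t))
    (hγ : HasMFDerivAt 𝓘(ℝ, ℝ) 𝓘(ℝ, E) γ t ((1 : ℝ →L[ℝ] ℝ).smulRight v)) :
    HasDerivAt (fun t => f (γ t)) (differential f (γ t) v) t := by
  let D : E →L[ℝ] ℝ := differential f (γ t)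
  have h : HasFDerivAt (fun t => f (γ t)) (D ∘L (1 : ℝ →L[ℝ] ℝ).smulRight v) t :=
    hasMFDerivAt_iff_hasFDerivAt.1 (hf.hasMFDerivAt.comp t hγ)
  have h2 : (D ∘L (1 : ℝ →L[ℝ] ℝ).smulRight v) 1 = D v := by simp
  exact h2 ▸ h.hasDerivAt

end Chart

/-! ### The tangent lift and differentials of expectation values -/

section Lift

variable {H : Type*} [NormedAddCommGroup H] [InnerProductSpace ℂ H]
  {E : Type*} [NormedAddCommGroup E] [NormedSpace ℝ E]
  {S : Type*} [TopologicalSpace S] [ChartedSpace E S]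

/-- The derivative at `s` of `s' ↦ P_{s'} u`, for the unit vector `u` of the ray `ι s`. -/
def tangentLift (E : Type*) [NormedAddCommGroup E] [NormedSpace ℝ E] [ChartedSpace E S]
    (ι : S → ℙ ℂ H) (s : S) : E →L[ℝ] H :=
  mfderiv 𝓘(ℝ, E) 𝓘(ℝ, H) (fun s' => rayProj (ι s') (unitVec (ι s))) s

theorem rayProj_unitVec (ρ : ℙ ℂ H) : rayProj ρ (unitVec ρ) = unitVec ρ := by
  rw [rayProj_eq, inner_unitVec_self, one_smul]

theorem norm_sq_rayProj (ρ : ℙ ℂ H) (x : H) : (‖rayProj ρ x‖ ^ 2 : ℂ) = inner ℂ x (rayProj ρ x) := by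
  rw [rayProj_eq, inner_smul_right, norm_smul, norm_unitVec, mul_one, ← inner_conj_symm x,
    Complex.mul_conj']

theorem gelfand_mul_norm_sq (A : H →L[ℂ] H) (ρ : ℙ ℂ H) (x : H) :
    gelfand A ρ * ‖rayProj ρ x‖ ^ 2 = (inner ℂ (rayProj ρ x) (A (rayProj ρ x))).re := by
  rw [gelfand_eq, rayProj_eq, map_smul, inner_smul_left, inner_smul_right, norm_smul, norm_unitVec,
    mul_one, ← mul_assoc, Complex.conj_mul', ← Complex.ofReal_pow, Complex.re_ofReal_mul, mul_comm]

theorem transProb_mul_norm_sq (ρ σ : ℙ ℂ H) (x y : H) :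
    transProb ρ σ * (‖rayProj ρ x‖ ^ 2 * ‖rayProj σ y‖ ^ 2)
      = ‖inner ℂ (rayProj ρ x) (rayProj σ y)‖ ^ 2 := by
  rw [transProb_eq, rayProj_eq, rayProj_eq, inner_smul_left, inner_smul_right, norm_smul, norm_smul,
    norm_mul, norm_mul, norm_unitVec, norm_unitVec, RCLike.norm_conj]
  ring

variable [CompleteSpace H] [IsManifold 𝓘(ℝ, E) ∞ S]

/-- All expectation value functions are smooth along `ι`. -/
def IsWeaklySmooth (E : Type*) [NormedAddCommGroup E] [NormedSpace ℝ E] [ChartedSpace E S]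
    (ι : S → ℙ ℂ H) : Prop :=
  ∀ A : H →L[ℂ] H, IsSelfAdjoint A →
    ContMDiff 𝓘(ℝ, E) 𝓘(ℝ, ℝ) ∞ (fun s => gelfand A (ι s))

variable {ι : S → ℙ ℂ H}

theorem IsWeaklySmooth.exists_hasStrictFDerivAt (hι : IsWeaklySmooth E ι) (s : S) (y : H) :
    ∃ D : E →L[ℝ] H, HasStrictFDerivAt
      (fun z => rayProj (ι ((extChartAt 𝓘(ℝ, E) s).symm z)) y) D (extChartAt 𝓘(ℝ, E) s s) := by
  let _ : InnerProductSpace ℝ H := InnerProductSpace.complexToReal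
  refine exists_hasStrictFDerivAt_of_inner (F := H) fun w => ?_
  have h := contDiffAt_comp_extChartAt_symm (hι _ (isSelfAdjoint_symRankOne y w)) s
  simp only [gelfand_symRankOne] at h
  exact h.of_le ENat.LEInfty.out

theorem IsWeaklySmooth.hasMFDerivAt (hι : IsWeaklySmooth E ι) (s : S) :
    HasMFDerivAt 𝓘(ℝ, E) 𝓘(ℝ, H) (fun s' => rayProj (ι s') (unitVec (ι s))) s
      (tangentLift (H := H) E ι s) := by
  obtain ⟨D, hD⟩ := hι.exists_hasStrictFDerivAt s (unitVec (ι s))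
  exact (hasMFDerivAt_of_hasFDerivAt_comp_symm (F := H)
    (f := fun s' => rayProj (ι s') (unitVec (ι s))) hD.hasFDerivAt).mdifferentiableAt.hasMFDerivAt

theorem IsWeaklySmooth.hasStrictFDerivAt (hι : IsWeaklySmooth E ι) (s : S) :
    HasStrictFDerivAt (fun z => rayProj (ι ((extChartAt 𝓘(ℝ, E) s).symm z)) (unitVec (ι s)))
      (tangentLift E ι s) (extChartAt 𝓘(ℝ, E) s s) := by
  obtain ⟨D, hD⟩ := hι.exists_hasStrictFDerivAt s (unitVec (ι s))
  have := (hasFDerivAt_comp_symm_of_hasMFDerivAt (F := H) (hι.hasMFDerivAt s)).unique hD.hasFDerivAt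
  rwa [this]

theorem IsWeaklySmooth.horizontalLift_eq (hι : IsWeaklySmooth E ι) (s : S)
    (v : TangentSpace 𝓘(ℝ, E) s) :
    horizontalLift E ι s v = ‖(ι s).rep‖ • tangentLift E ι s v := by
  have h := (hasFDerivAt_comp_symm_of_hasMFDerivAt (F := H) (hι.hasMFDerivAt s)).const_smul ‖(ι s).rep‖
  have h2 : (fun s' => rayProj (ι s') (ι s).rep)
      = fun s' => ‖(ι s).rep‖ • rayProj (ι s') (unitVec (ι s)) := by
    funext s'
    conv_lhs => rw [rep_eq_smul_unitVec (ι s), rayProj_eq, inner_smul_right, mul_smul]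
    rw [rayProj_eq]
    exact Complex.coe_smul _ _
  have h3 := (hasMFDerivAt_of_hasFDerivAt_comp_symm (F := H)
    (f := fun s' => ‖(ι s).rep‖ • rayProj (ι s') (unitVec (ι s))) h).mfderiv
  rw [horizontalLift, h2, h3]
  rfl

theorem IsWeaklySmooth.inner_tangentLift (hι : IsWeaklySmooth E ι) (s : S) (v : E) :
    inner ℂ (unitVec (ι s)) (tangentLift E ι s v) = 0 := by
  have h := (hι.hasStrictFDerivAt s).hasFDerivAt
  have h0 : rayProj (ι ((extChartAt 𝓘(ℝ, E) s).symm (extChartAt 𝓘(ℝ, E) s s))) (unitVec (ι s))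
      = unitVec (ι s) := by
    rw [extChartAt_to_inv, rayProj_unitVec]
  have h1 := HasFDerivAt.inner ℂ (hasFDerivAt_const (unitVec (ι s)) _) h
  have h2 := HasFDerivAt.inner ℂ h h
  -- Differentiating ⟨Pu, Pu⟩ = ⟨u, Pu⟩ gives ⟨u, Lv⟩ + ⟨Lv, u⟩ = ⟨u, Lv⟩, so ⟨Lv, u⟩ = 0 without
  -- any choice of phase.
  have h3 : (fun z => inner ℂ (rayProj (ι ((extChartAt 𝓘(ℝ, E) s).symm z)) (unitVec (ι s)))
      (rayProj (ι ((extChartAt 𝓘(ℝ, E) s).symm z)) (unitVec (ι s))))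
      = fun z => inner ℂ (unitVec (ι s))
        (rayProj (ι ((extChartAt 𝓘(ℝ, E) s).symm z)) (unitVec (ι s))) := by
    funext z
    rw [← norm_sq_rayProj, inner_self_eq_norm_sq_to_K]
    rfl
  rw [h3] at h2
  have h4 := DFunLike.congr_fun (h1.unique h2) v
  rw [h0] at h4
  simp only [comp_apply, fderivInnerCLM_apply, prod_apply, zero_apply, inner_zero_left,
    add_zero] at h4
  rw [← inner_conj_symm, left_eq_add.1 h4, map_zero]

/-- Differentiate Â ‖Pu‖² = Re⟨Pu, A Pu⟩; the factor ‖Pu‖² is stationary at s because Lv ⊥ u. -/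
theorem IsWeaklySmooth.differential_gelfand (hι : IsWeaklySmooth E ι) {A : H →L[ℂ] H}
    (hA : IsSelfAdjoint A) (s : S) (v : E) :
    differential (fun s' => gelfand A (ι s')) s v
      = 2 * (inner ℂ (A (unitVec (ι s))) (tangentLift E ι s v)).re := by
  let _ : InnerProductSpace ℝ H := InnerProductSpace.complexToReal
  have h := (hι.hasStrictFDerivAt s).hasFDerivAt
  have h0 : rayProj (ι ((extChartAt 𝓘(ℝ, E) s).symm (extChartAt 𝓘(ℝ, E) s s))) (unitVec (ι s))
      = unitVec (ι s) := by
    rw [extChartAt_to_inv, rayProj_unitVec]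
  have hg := hasFDerivAt_comp_symm_of_hasMFDerivAt (F := ℝ)
    ((hι A hA).mdifferentiable (by simp) s).hasMFDerivAt
  have h1 := hg.mul h.norm_sq
  have h2 := HasFDerivAt.inner ℝ h ((A.restrictScalars ℝ).hasFDerivAt.comp _ h)
  have h3 := DFunLike.congr_fun (h1.unique (h2.congr_of_eventuallyEq
    (Eventually.of_forall fun z => gelfand_mul_norm_sq A _ _))) v
  have h4 : (inner ℂ (unitVec (ι s)) (A (tangentLift E ι s v))).re
      = (inner ℂ (A (unitVec (ι s))) (tangentLift E ι s v)).re := by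
    rw [← adjoint_inner_left, hA.adjoint_eq]
  have hre : ∀ a b : H, inner ℝ a b = (inner ℂ a b).re := fun _ _ => rfl
  have h5 : (inner ℂ (tangentLift E ι s v) (A (unitVec (ι s)))).re
      = (inner ℂ (A (unitVec (ι s))) (tangentLift E ι s v)).re := by
    rw [← inner_conj_symm, Complex.conj_re]
  simp only [Function.comp_apply, extChartAt_to_inv, rayProj_unitVec, norm_unitVec, one_pow,
    add_apply, smul_apply, comp_apply, innerSL_apply_apply, hre, hι.inner_tangentLift,
    Complex.zero_re, smul_zero, zero_add, fderivInnerCLM_apply, prod_apply,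
    coe_restrictScalars', h4, h5] at h3
  rw [differential, two_mul, ← h3]
  exact DFunLike.congr_fun (one_smul ℝ _).symm v

end Lift

/-! ### Infinitesimal invariance of transition probabilities -/

section Curves

variable {H : Type*} [NormedAddCommGroup H] [InnerProductSpace ℂ H] [CompleteSpace H]
  {E : Type*} [NormedAddCommGroup E] [NormedSpace ℝ E]
  {S : Type*} [TopologicalSpace S] [ChartedSpace E S] [IsManifold 𝓘(ℝ, E) ∞ S]
  {ι : S → ℙ ℂ H}

theorem IsWeaklySmooth.hasDerivAt_rayProj (hι : IsWeaklySmooth E ι) {γ : ℝ → S} {t : ℝ} {v : E}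
    (hγ : HasMFDerivAt 𝓘(ℝ, ℝ) 𝓘(ℝ, E) γ t ((1 : ℝ →L[ℝ] ℝ).smulRight v)) :
    HasDerivAt (fun t' => rayProj (ι (γ t')) (unitVec (ι (γ t)))) (tangentLift E ι (γ t) v) t := by
  have h := (hι.hasMFDerivAt (γ t)).comp t hγ
  have h2 : HasFDerivAt (fun t' => rayProj (ι (γ t')) (unitVec (ι (γ t))))
      (tangentLift E ι (γ t) ∘L (1 : ℝ →L[ℝ] ℝ).smulRight v) t :=
    hasMFDerivAt_iff_hasFDerivAt.1 h
  simpa using h2.hasDerivAt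

theorem IsWeaklySmooth.re_add_re_eq_zero (hι : IsWeaklySmooth E ι) {γ η : ℝ → S} {v w : E}
    (hγ : HasMFDerivAt 𝓘(ℝ, ℝ) 𝓘(ℝ, E) γ 0 ((1 : ℝ →L[ℝ] ℝ).smulRight v))
    (hη : HasMFDerivAt 𝓘(ℝ, ℝ) 𝓘(ℝ, E) η 0 ((1 : ℝ →L[ℝ] ℝ).smulRight w))
    (h : ∀ᶠ t in 𝓝 0, transProb (ι (γ t)) (ι (η t)) = transProb (ι (γ 0)) (ι (η 0))) :
    (inner ℂ (inner ℂ (unitVec (ι (η 0))) (unitVec (ι (γ 0))) • unitVec (ι (η 0)))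
        (tangentLift E ι (γ 0) v)).re
      + (inner ℂ (inner ℂ (unitVec (ι (γ 0))) (unitVec (ι (η 0))) • unitVec (ι (γ 0)))
        (tangentLift E ι (η 0) w)).re = 0 := by
  let _ : InnerProductSpace ℝ H := InnerProductSpace.complexToReal
  have hre : ∀ a b : H, inner ℝ a b = (inner ℂ a b).re := fun _ _ => rfl
  have ha := hι.hasDerivAt_rayProj hγ
  have hb := hι.hasDerivAt_rayProj hη
  have h1 := ((ha.norm_sq.mul hb.norm_sq).const_mul (transProb (ι (γ 0)) (ι (η 0))))
  have h2 := (HasDerivAt.inner ℂ ha hb).norm_sq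
  have h3 := h1.unique (h2.congr_of_eventuallyEq (h.mono fun t ht => by
    change transProb (ι (γ 0)) (ι (η 0)) * _ = _
    rw [← ht]
    exact transProb_mul_norm_sq _ _ _ _))
  simp only [hre, rayProj_unitVec, hι.inner_tangentLift, Complex.zero_re, mul_zero, zero_mul,
    add_zero] at h3
  rw [Complex.inner, mul_comm (_ + _)] at h3
  rw [inner_smul_left, inner_smul_left, ← inner_conj_symm (unitVec (ι (η 0))) (tangentLift E ι _ v),
    ← inner_conj_symm (unitVec (ι (η 0))) (unitVec (ι (γ 0))), ← map_mul, Complex.conj_re,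
    ← Complex.add_re, ← mul_add, add_comm]
  linarith

end Curves

/-! ### The Poisson tensor transported to the Hilbert space -/

section HamLift

variable {H : Type*} [NormedAddCommGroup H] [InnerProductSpace ℂ H]
  {E : Type*} [NormedAddCommGroup E] [NormedSpace ℝ E]
  {S : Type*} [TopologicalSpace S] [ChartedSpace E S]

/-- The covector `v ↦ 2 Re ⟨w, L v⟩` at `s`, where `L` is the tangent lift. -/
def tangentCovector (E : Type*) [NormedAddCommGroup E] [NormedSpace ℝ E] [ChartedSpace E S]
    (ι : S → ℙ ℂ H) (s : S) : H →L[ℝ] E →L[ℝ] ℝ :=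
  LinearMap.mkContinuous₂
    (LinearMap.mk₂ ℝ (fun w v => 2 * (inner ℂ w (tangentLift E ι s v)).re)
      (fun a b v => by rw [inner_add_left, Complex.add_re, mul_add])
      (fun c a v => by
        rw [← Complex.coe_smul, inner_smul_left, Complex.conj_ofReal, Complex.re_ofReal_mul,
          smul_eq_mul]
        ring)
      (fun a v w => by rw [map_add, inner_add_right, Complex.add_re, mul_add])
      (fun c a v => by
        rw [map_smul, ← Complex.coe_smul, inner_smul_right, Complex.re_ofReal_mul, smul_eq_mul]
        ring))
    (2 * ‖tangentLift E ι s‖) (fun w v => by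
      rw [LinearMap.mk₂_apply, norm_mul, Real.norm_two, mul_assoc, mul_assoc]
      refine mul_le_mul_of_nonneg_left ?_ two_pos.le
      refine (Complex.abs_re_le_norm _).trans ((norm_inner_le_norm _ _).trans ?_)
      rw [mul_left_comm]
      exact mul_le_mul_of_nonneg_left (le_opNorm _ _) (norm_nonneg _))

theorem tangentCovector_apply (ι : S → ℙ ℂ H) (s : S) (w : H) (v : E) :
    tangentCovector E ι s w v = 2 * (inner ℂ w (tangentLift E ι s v)).re := rfl

variable [IsManifold 𝓘(ℝ, E) ∞ S] [CompleteSpace E]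

/-- The vector dual to `tangentCovector`. -/
def hamVector (Ω : SymplecticForm E S) (ι : S → ℙ ℂ H) (s : S) : H →L[ℝ] E :=
  ((Ω.flat s).symm : (E →L[ℝ] ℝ) →L[ℝ] E) ∘L tangentCovector E ι s

theorem form_hamVector (Ω : SymplecticForm E S) (ι : S → ℙ ℂ H) (s : S) (w : H) (v : E) :
    Ω.form s (hamVector Ω ι s w) v = 2 * (inner ℂ w (tangentLift E ι s v)).re := by
  rw [← tangentCovector_apply]
  exact DFunLike.congr_fun ((Ω.flat s).apply_symm_apply (tangentCovector E ι s w)) v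

/-- The Poisson tensor of `Ω` transported to the Hilbert space along the tangent lift. -/
def hamLift (Ω : SymplecticForm E S) (ι : S → ℙ ℂ H) (s : S) : H →L[ℝ] H :=
  tangentLift E ι s ∘L hamVector Ω ι s

theorem hamLift_apply (Ω : SymplecticForm E S) (ι : S → ℙ ℂ H) (s : S) (w : H) :
    hamLift Ω ι s w = tangentLift E ι s (hamVector Ω ι s w) := rfl

theorem hamLift_skew (Ω : SymplecticForm E S) (ι : S → ℙ ℂ H) (s : S) (w w' : H) :
    (inner ℂ w' (hamLift Ω ι s w)).re = -(inner ℂ w (hamLift Ω ι s w')).re := by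
  have h1 := form_hamVector Ω ι s w' (hamVector Ω ι s w)
  have h2 := form_hamVector Ω ι s w (hamVector Ω ι s w')
  have h3 := Ω.form_swap s (hamVector Ω ι s w) (hamVector Ω ι s w')
  simp only [hamLift_apply]
  linarith

theorem hamLift_eq_zero_of_inner_eq_zero (Ω : SymplecticForm E S) {ι : S → ℙ ℂ H} {s : S} {x : H}
    (h : ∀ v, inner ℂ x (tangentLift E ι s v) = 0) : hamLift Ω ι s x = 0 := by
  have h1 : hamVector Ω ι s x = 0 := by
    apply Ω.form_injective s
    refine ContinuousLinearMap.ext fun v => (form_hamVector Ω ι s x v).trans ?_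
    have hv : 2 * (inner ℂ x (tangentLift E ι s (v : E))).re = 0 := by
      rw [h v, Complex.zero_re, mul_zero]
    exact hv.trans (DFunLike.congr_fun (map_zero (Ω.form s)) v).symm
  rw [hamLift_apply, h1, map_zero]

variable [CompleteSpace H] {ι : S → ℙ ℂ H}

theorem IsWeaklySmooth.hamVF_gelfand (hι : IsWeaklySmooth E ι) (Ω : SymplecticForm E S)
    {A : H →L[ℂ] H} (hA : IsSelfAdjoint A) (s : S) :
    Ω.hamVF (fun s' => gelfand A (ι s')) s = hamVector Ω ι s (A (unitVec (ι s))) := by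
  apply Ω.form_injective s
  refine ContinuousLinearMap.ext fun v => ?_
  exact (DFunLike.congr_fun (Ω.form_hamVF _ s) v).trans
    ((hι.differential_gelfand hA s v).trans (form_hamVector Ω ι s _ v).symm)

theorem IsWeaklySmooth.bracket_gelfand (hι : IsWeaklySmooth E ι) (Ω : SymplecticForm E S)
    {A B : H →L[ℂ] H} (hA : IsSelfAdjoint A) (hB : IsSelfAdjoint B) (s : S) :
    Ω.bracket (fun s' => gelfand A (ι s')) (fun s' => gelfand B (ι s')) s
      = 2 * (inner ℂ (B (unitVec (ι s))) (hamLift Ω ι s (A (unitVec (ι s))))).re := by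
  rw [SymplecticForm.bracket, hι.hamVF_gelfand Ω hA, hι.differential_gelfand hB]
  rfl

theorem IsWeaklySmooth.re_add_re_eq_zero_of_isUnitary (hι : IsWeaklySmooth E ι)
    [TopologicalSpace (ℙ ℂ H)] (Ω : SymplecticForm E S) (hU : IsUnitary Ω ι transProb)
    {A : H →L[ℂ] H} (hA : IsSelfAdjoint A) (hs : IsLeafSmooth E ι (gelfand A)) (s s' : S) :
    (inner ℂ (inner ℂ (unitVec (ι s')) (unitVec (ι s)) • unitVec (ι s'))
        (hamLift Ω ι s (A (unitVec (ι s))))).re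
      + (inner ℂ (inner ℂ (unitVec (ι s)) (unitVec (ι s')) • unitVec (ι s))
        (hamLift Ω ι s' (A (unitVec (ι s'))))).re = 0 := by
  have hone : IsManifold 𝓘(ℝ, E) 1 S := IsManifold.of_le (n := ∞) (by simp)
  obtain ⟨γ, rfl, hγ⟩ := exists_isMIntegralCurveAt_of_contMDiffAt_boundaryless 0
    (Ω.contMDiffAt_hamVF hs.2 s)
  obtain ⟨η, rfl, hη⟩ := exists_isMIntegralCurveAt_of_contMDiffAt_boundaryless 0
    (Ω.contMDiffAt_hamVF hs.2 s')
  obtain ⟨ε₁, hε₁, h₁⟩ := isMIntegralCurveAt_iff'.1 hγ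
  obtain ⟨ε₂, hε₂, h₂⟩ := isMIntegralCurveAt_iff'.1 hη
  have hε : 0 < min ε₁ ε₂ := lt_min hε₁ hε₂
  have hball : ∀ ε, Metric.ball (0 : ℝ) ε = Set.Ioo (-ε) ε := fun ε => by
    rw [Real.ball_eq_Ioo, zero_sub, zero_add]
  have h := hU (gelfand A) (gelfand_mem_bidualObservables A) hs γ η (-min ε₁ ε₂) (min ε₁ ε₂)
    (by linarith) hε
    (hball (min ε₁ ε₂) ▸ h₁.mono (Metric.ball_subset_ball (min_le_left _ _)))
    (hball (min ε₁ ε₂) ▸ h₂.mono (Metric.ball_subset_ball (min_le_right _ _)))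
  have h3 := hι.re_add_re_eq_zero hγ.self_of_nhds hη.self_of_nhds
    (eventually_of_mem (Ioo_mem_nhds (by linarith) hε) h)
  rw [hι.hamVF_gelfand Ω hA, hι.hamVF_gelfand Ω hA] at h3
  exact h3

end HamLift

/-! ### Extension from V to all self-adjoint operators -/

section WeakDensity

variable {H : Type*} [NormedAddCommGroup H] [InnerProductSpace ℂ H] [CompleteSpace H]
  {V : Submodule ℝ (selfAdjoint (H →L[ℂ] H))}

theorem IsWeaklyDense.re_inner_add_re_inner_eq_zero (hV : IsWeaklyDense V) {a b x y : H}
    (h : ∀ B ∈ V, (inner ℂ a ((B : H →L[ℂ] H) x)).re + (inner ℂ b ((B : H →L[ℂ] H) y)).re = 0)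
    {A : H →L[ℂ] H} (hA : IsSelfAdjoint A) :
    (inner ℂ a (A x)).re + (inner ℂ b (A y)).re = 0 := by
  let g : (H →WOT[ℂ] H) → ℝ := fun T => (inner ℂ a (T x)).re + (inner ℂ b (T y)).re
  have hg : Continuous g := by
    have h1 : ∀ a x : H, Continuous fun T : H →WOT[ℂ] H => inner ℂ a (T x) := fun a x =>
      ContinuousLinearMapWOT.continuous_dual_apply x (innerSL ℂ a)
    exact (Complex.continuous_re.comp (h1 a x)).add (Complex.continuous_re.comp (h1 b y))
  have hcl : IsClosed {T | g T = 0} := isClosed_singleton.preimage hg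
  exact closure_minimal (by rintro _ ⟨B, hB, rfl⟩; exact h B hB) hcl (hV ⟨A, hA⟩)

end WeakDensity

/-! ### Injectivity of the tangent lift -/

section Injective

/-- The right inverse splits the kernel, so the implicit function theorem parametrizes the fibre
through a by a neighbourhood of 0 in the kernel; local injectivity reduces this to a point. -/
theorem _root_.HasStrictFDerivAt.injective_of_injOn {E F : Type*} [NormedAddCommGroup E]
    [NormedSpace ℝ E] [CompleteSpace E] [NormedAddCommGroup F] [NormedSpace ℝ F] [CompleteSpace F]
    {f : E → F} {f' : E →L[ℝ] F} {a : E} (hf : HasStrictFDerivAt f f' a) (N : F →L[ℝ] E)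
    (hN : Function.RightInverse N f') {U : Set E} (hU : U ∈ 𝓝 a) (hinj : Set.InjOn f U) :
    Function.Injective f' := by
  have hrange : f'.range = ⊤ := LinearMap.range_eq_top.2 hN.surjective
  have hker : f'.ker.ClosedComplemented := closedComplemented_ker_of_rightInverse f' N hN
  let Φ := hf.implicitToOpenPartialHomeomorphOfComplemented f f' hrange hker
  have ha : a ∈ Φ.source := hf.mem_implicitToOpenPartialHomeomorphOfComplemented_source hrange hker
  have hΦa : Φ a = (f a, 0) :=
    hf.implicitToOpenPartialHomeomorphOfComplemented_self hrange hker
  have hcont : Tendsto (fun k => Φ.symm (f a, k)) (𝓝 (0 : f'.ker)) (𝓝 a) := by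
    have h1 : Tendsto Φ.symm (𝓝 (f a, 0)) (𝓝 a) := by
      have := Φ.continuousAt_symm (Φ.map_source ha)
      rw [ContinuousAt, Φ.left_inv ha, hΦa] at this
      exact this
    exact h1.comp ((Continuous.prodMk_right (f a)).tendsto' _ _ rfl)
  have htgt : ∀ᶠ k in 𝓝 (0 : f'.ker), (f a, k) ∈ Φ.target :=
    ((Continuous.prodMk_right (f a)).tendsto' (0 : f'.ker) _ rfl).eventually
      (hΦa ▸ Φ.open_target.mem_nhds (Φ.map_source ha))
  have hzero : ∀ᶠ k in 𝓝 (0 : f'.ker), k = 0 := by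
    filter_upwards [htgt, hcont hU] with k hk hkU
    have h1 : f (Φ.symm (f a, k)) = f a := by
      have h2 := hf.implicitToOpenPartialHomeomorphOfComplemented_fst hrange hker (Φ.symm (f a, k))
      rw [← h2]
      exact congrArg Prod.fst (Φ.right_inv hk)
    have h3 : Φ.symm (f a, k) = a := hinj hkU (mem_of_mem_nhds hU) h1
    have h4 := Φ.right_inv hk
    rw [h3, hΦa] at h4
    exact (congrArg Prod.snd h4).symm
  refine (injective_iff_map_eq_zero f').2 fun v hv => ?_
  have hlim : Tendsto (fun t : ℝ => t • (⟨v, hv⟩ : f'.ker)) (𝓝[≠] 0) (𝓝 0) := by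
    have : Continuous fun t : ℝ => t • (⟨v, hv⟩ : f'.ker) := by fun_prop
    exact (this.tendsto' 0 0 (zero_smul ℝ _)).mono_left nhdsWithin_le_nhds
  obtain ⟨t, ht, ht0⟩ := ((hlim.eventually hzero).and self_mem_nhdsWithin).exists
  exact congrArg Subtype.val ((smul_eq_zero.1 ht).resolve_left ht0)

theorem subsingleton_of_eventually_eq {E : Type*} [NormedAddCommGroup E] [NormedSpace ℝ E] {z₀ : E}
    (h : ∀ᶠ z in 𝓝 z₀, z = z₀) : Subsingleton E := by
  by_contra hE
  rw [not_subsingleton_iff_nontrivial] at hE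
  have := Module.punctured_nhds_neBot ℝ E z₀
  obtain ⟨z, hz, hz'⟩ := ((h.filter_mono nhdsWithin_le_nhds).and
    (self_mem_nhdsWithin : {z₀}ᶜ ∈ 𝓝[≠] z₀)).exists
  exact hz' hz

theorem subsingleton_of_differential_eq_zero {E : Type*} [NormedAddCommGroup E] [NormedSpace ℝ E]
    {S : Type*} [TopologicalSpace S] [ChartedSpace E S] [IsManifold 𝓘(ℝ, E) ∞ S] {𝔄 : Set (S → ℝ)}
    (hsep : ∀ s s', (∀ f ∈ 𝔄, f s = f s') → s = s')
    (hd : ∀ f ∈ 𝔄, MDifferentiable 𝓘(ℝ, E) 𝓘(ℝ, ℝ) f)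
    (h : ∀ f ∈ 𝔄, ∀ s : S, ∀ v : E, differential f s v = 0) [Nonempty S] : Subsingleton E := by
  obtain ⟨s⟩ := ‹Nonempty S›
  have hone : IsManifold 𝓘(ℝ, E) 1 S := IsManifold.of_le (n := ∞) (by simp)
  let φ := extChartAt 𝓘(ℝ, E) s
  obtain ⟨ε, hε, hball⟩ := Metric.mem_nhds_iff.1 (extChartAt_target_mem_nhds (I := 𝓘(ℝ, E)) s)
  refine subsingleton_of_eventually_eq (z₀ := φ s) ?_
  filter_upwards [Metric.ball_mem_nhds _ hε] with z hz
  refine φ.symm.injOn (hball hz) (hball (Metric.mem_ball_self hε)) (hsep _ _ fun f hf => ?_)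
  have hderiv : ∀ z ∈ Metric.ball (φ s) ε, HasFDerivAt (fun z => f (φ.symm z)) (0 : E →L[ℝ] ℝ) z := by
    intro z hz
    obtain ⟨D, hD⟩ : ∃ D : E →L[ℝ] E, HasMFDerivAt 𝓘(ℝ, E) 𝓘(ℝ, E) φ.symm z D :=
      ⟨_, ((mdifferentiableOn_extChartAt_symm (I := 𝓘(ℝ, E)) (x := s)).mdifferentiableAt
        ((isOpen_extChartAt_target s).mem_nhds (hball hz))).hasMFDerivAt⟩
    have h2 := (hd f hf (φ.symm z)).hasMFDerivAt.comp z hD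
    have h3 : mfderiv 𝓘(ℝ, E) 𝓘(ℝ, ℝ) f (φ.symm z) = 0 :=
      ContinuousLinearMap.ext fun v => h f hf (φ.symm z) v
    rw [h3] at h2
    have h4 : HasFDerivAt (fun z => f (φ.symm z))
        ((0 : E →L[ℝ] ℝ) ∘L D) z :=
      hasMFDerivAt_iff_hasFDerivAt.1 h2
    rwa [zero_comp] at h4
  exact Metric.isOpen_ball.is_const_of_fderiv_eq_zero (convex_ball (φ s) ε).isPreconnected
    (fun z hz => (hderiv z hz).differentiableAt.differentiableWithinAt)
    (fun z hz => (hderiv z hz).fderiv) hz (Metric.mem_ball_self hε)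

variable {H : Type*} [NormedAddCommGroup H] [InnerProductSpace ℂ H]

theorem rayProj_eq_add (ρ : ℙ ℂ H) {u : H} (hu : ‖u‖ = 1) :
    rayProj ρ u = (‖rayProj ρ u‖ ^ 2 : ℝ) • u + (ℂ ∙ u)ᗮ.starProjection (rayProj ρ u) := by
  rw [Submodule.starProjection_orthogonal_val, Submodule.starProjection_unit_singleton _ hu,
    ← norm_sq_rayProj, ← Complex.coe_smul]
  push_cast
  abel

theorem eq_of_starProjection_rayProj_eq {ρ σ : ℙ ℂ H} {u : H} (hu : ‖u‖ = 1)
    (hρ : 1 / 2 < ‖rayProj ρ u‖ ^ 2) (hσ : 1 / 2 < ‖rayProj σ u‖ ^ 2)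
    (h : (ℂ ∙ u)ᗮ.starProjection (rayProj ρ u) = (ℂ ∙ u)ᗮ.starProjection (rayProj σ u)) :
    ρ = σ := by
  have key : ∀ τ : ℙ ℂ H, ‖rayProj τ u‖ ^ 2
      = (‖rayProj τ u‖ ^ 2) ^ 2 + ‖(ℂ ∙ u)ᗮ.starProjection (rayProj τ u)‖ ^ 2 := by
    intro τ
    have h1 := (ℂ ∙ u).norm_sq_eq_add_norm_sq_starProjection (rayProj τ u)
    rw [Submodule.starProjection_unit_singleton _ hu, ← norm_sq_rayProj, norm_smul, hu, mul_one,
      ← Complex.ofReal_pow, Complex.norm_real, Real.norm_of_nonneg (by positivity)] at h1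
    exact h1
  have h1 := key ρ
  have h2 := key σ
  rw [h] at h1
  -- Both squared norms t have the same value of t - t², which is injective on t > 1/2.
  have hpq : ‖rayProj ρ u‖ ^ 2 = ‖rayProj σ u‖ ^ 2 := by
    nlinarith
  have heq : rayProj ρ u = rayProj σ u := by
    rw [rayProj_eq_add ρ hu, rayProj_eq_add σ hu, hpq, h]
  have hne : rayProj ρ u ≠ 0 := fun h0 => by
    rw [h0] at hρ
    norm_num at hρ
  rw [rayProj_eq] at hne
  have hne' : inner ℂ (unitVec ρ) u ≠ 0 := fun h0 => hne (by rw [h0, zero_smul])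
  rw [rayProj_eq, rayProj_eq] at heq
  refine eq_of_unitVec_eq_smul (c := (inner ℂ (unitVec ρ) u)⁻¹ * inner ℂ (unitVec σ) u) ?_
  rw [mul_smul, ← heq, inv_smul_smul₀ hne']

variable [CompleteSpace H]
  {E : Type*} [NormedAddCommGroup E] [NormedSpace ℝ E] [CompleteSpace E]
  {S : Type*} [TopologicalSpace S] [ChartedSpace E S] [IsManifold 𝓘(ℝ, E) ∞ S]
  {ι : S → ℙ ℂ H}

theorem IsWeaklySmooth.tangentLift_injective_of_ne_zero (hι : IsWeaklySmooth E ι)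
    (hinj : Function.Injective ι) (Ω : SymplecticForm E S) {c : ℝ} (hc : c ≠ 0) {s : S}
    (h : ∀ w, inner ℂ (unitVec (ι s)) w = 0 → hamLift Ω ι s w = c • Complex.I • w) :
    Function.Injective (tangentLift E ι s) := by
  set u := unitVec (ι s) with hu
  have hnu : ‖u‖ = 1 := norm_unitVec _
  let K : Submodule ℂ H := (ℂ ∙ u)ᗮ
  let Q : H →L[ℝ] K := K.orthogonalProjectionOnto.restrictScalars ℝ
  let z₀ := extChartAt 𝓘(ℝ, E) s s
  let f : E → H := fun z => rayProj (ι ((extChartAt 𝓘(ℝ, E) s).symm z)) u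
  have hf : HasStrictFDerivAt f (tangentLift E ι s) z₀ := hι.hasStrictFDerivAt s
  have hQf : HasStrictFDerivAt (fun z => Q (f z)) (Q ∘L tangentLift E ι s) z₀ :=
    Q.hasStrictFDerivAt.comp z₀ hf
  -- `J` inverts c·i on u^⊥, so `hamLift` ∘ `J` is the inclusion of u^⊥ and `hamVector` ∘ `J` is a
  -- right inverse of the lift.
  let J : K →L[ℝ] H := (-c⁻¹) • ((Complex.I • K.subtypeL).restrictScalars ℝ)
  have hN : Function.RightInverse (hamVector Ω ι s ∘L J) (Q ∘L tangentLift E ι s) := by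
    intro w
    have hw := Submodule.mem_orthogonal_singleton_iff_inner_right.1 w.2
    have hJ : J w = (-c⁻¹) • Complex.I • (w : H) := rfl
    have hJu : inner ℂ u (J w) = 0 := by
      rw [hJ, ← Complex.coe_smul, inner_smul_right, inner_smul_right, hw, mul_zero, mul_zero]
    have h1 : hamLift Ω ι s (J w) = w := by
      rw [h _ hJu, hJ, smul_comm Complex.I, smul_smul, smul_smul Complex.I, Complex.I_mul_I,
        neg_one_smul, smul_neg, ← neg_smul, mul_neg, neg_neg, mul_inv_cancel₀ hc, one_smul]
    change Q (hamLift Ω ι s (J w)) = w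
    rw [h1]
    exact K.orthogonalProjectionOnto_mem_subspace_eq_self w
  have hz₀ : f z₀ = u := by
    simp only [f, z₀, extChartAt_to_inv]
    exact rayProj_unitVec _
  have hU1 : ∀ᶠ z in 𝓝 z₀, 1 / 2 < ‖f z‖ ^ 2 := by
    have : ContinuousAt (fun z => ‖f z‖ ^ 2) z₀ := hf.continuousAt.norm.pow 2
    refine this.eventually (lt_mem_nhds ?_)
    change 1 / 2 < ‖f z₀‖ ^ 2
    rw [hz₀, hnu]
    norm_num
  have hU2 := extChartAt_target_mem_nhds (I := 𝓘(ℝ, E)) s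
  have key := hQf.injective_of_injOn _ hN (inter_mem hU1 hU2) (by
    rintro z ⟨hz1, hz2⟩ z' ⟨hz1', hz2'⟩ hzz
    have h1 : K.starProjection (f z) = K.starProjection (f z') := congrArg Subtype.val hzz
    exact (extChartAt 𝓘(ℝ, E) s).symm.injOn hz2 hz2'
      (hinj (eq_of_starProjection_rayProj_eq hnu hz1 hz1' h1)))
  exact Function.Injective.of_comp (f := Q) key

/-- The function p(ι(γ 0), ·) is itself an expectation value, so it stays equal to 1 along an
integral curve γ of Â; thus γ is constant near 0 and its velocity vanishes. -/
theorem IsWeaklySmooth.gelfand_hamVF_eq_zero (hι : IsWeaklySmooth E ι)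
    (hinj : Function.Injective ι) (Ω : SymplecticForm E S) {A : H →L[ℂ] H} (hA : IsSelfAdjoint A)
    (h : ∀ B : H →L[ℂ] H, IsSelfAdjoint B → ∀ s,
      Ω.bracket (fun s' => gelfand A (ι s')) (fun s' => gelfand B (ι s')) s = 0) (s : S) :
    Ω.hamVF (fun s' => gelfand A (ι s')) s = 0 := by
  have hone : IsManifold 𝓘(ℝ, E) 1 S := IsManifold.of_le (n := ∞) (by simp)
  obtain ⟨γ, rfl, hγ⟩ := exists_isMIntegralCurveAt_of_contMDiffAt_boundaryless 0
    (Ω.contMDiffAt_hamVF (hι A hA) s)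
  have hP := isSelfAdjoint_rankOne_self (unitVec (ι (γ 0)))
  have hd : ∀ᶠ t in 𝓝 (0 : ℝ), HasDerivAt (fun t => transProb (ι (γ 0)) (ι (γ t))) 0 t := by
    filter_upwards [hγ] with t ht
    have h1 := hasDerivAt_comp_of_hasMFDerivAt ((hι _ hP).mdifferentiable (by simp) (γ t)) ht
    have h2 : differential (fun s' => gelfand _ (ι s')) (γ t) _ = 0 := h _ hP (γ t)
    rw [h2] at h1
    exact h1.congr_of_eventuallyEq
      (Eventually.of_forall fun t => (gelfand_rankOne_unitVec _ _).symm)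
  have hconst : ∀ᶠ t in 𝓝 (0 : ℝ), γ t = γ 0 := by
    obtain ⟨ε, hε, hball⟩ := Metric.eventually_nhds_iff_ball.1 hd
    filter_upwards [Metric.ball_mem_nhds (0 : ℝ) hε] with t ht
    have h1 := Metric.isOpen_ball.is_const_of_deriv_eq_zero
      (convex_ball (0 : ℝ) ε).isPreconnected
      (fun t ht => (hball t ht).differentiableAt.differentiableWithinAt)
      (fun t ht => (hball t ht).deriv) ht (Metric.mem_ball_self hε)
    simp only [transProb_self] at h1
    exact (hinj (eq_of_transProb_eq_one h1)).symm
  have h0 : HasMFDerivAt 𝓘(ℝ, ℝ) 𝓘(ℝ, E) γ 0 (0 : ℝ →L[ℝ] E) :=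
    (hasMFDerivAt_const (γ 0) 0).congr_of_eventuallyEq hconst
  have h1 := hasMFDerivAt_unique hγ.self_of_nhds h0
  have h2 : (1 : ℝ) • (Ω.hamVF (fun s' => gelfand A (ι s')) (γ 0) : E) = 0 :=
    DFunLike.congr_fun h1 (1 : ℝ)
  rwa [one_smul] at h2

end Injective

/-! ### Determination of the bracket and of the form -/

section Main

variable {H : Type*} [NormedAddCommGroup H] [InnerProductSpace ℂ H] [CompleteSpace H]
  {E : Type*} [NormedAddCommGroup E] [NormedSpace ℝ E]
  {S : Type*} [TopologicalSpace S] [ChartedSpace E S] [IsManifold 𝓘(ℝ, E) ∞ S]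
  {ι : S → ℙ ℂ H}

theorem IsWeaklyDense.eq_zero_of_differential_eq_zero
    {V : Submodule ℝ (selfAdjoint (H →L[ℂ] H))} (hV : IsWeaklyDense V) (hι : IsWeaklySmooth E ι)
    {s : S} (hinj : Function.Injective (tangentLift E ι s)) {v : E}
    (h : ∀ A ∈ V, differential (fun s' => gelfand (A : H →L[ℂ] H) (ι s')) s v = 0) : v = 0 := by
  set d := tangentLift E ι s v with hd
  have hdu : inner ℂ (unitVec (ι s)) d = 0 := hι.inner_tangentLift s v
  -- By weak density the vanishing also holds for the symmetrized rank-one operator sending u to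
  -- d/2, which gives ‖d‖² = 0.
  have h1 := hV.re_inner_add_re_inner_eq_zero (a := d) (b := 0) (x := unitVec (ι s)) (y := 0)
    (fun B hB => by
      have h2 := h B hB
      rw [hι.differential_gelfand B.2, ← inner_conj_symm, Complex.conj_re] at h2
      rw [inner_zero_left, Complex.zero_re, add_zero]
      linarith) (isSelfAdjoint_symRankOne d (unitVec (ι s)))
  have h2 : symRankOne d (unitVec (ι s)) (unitVec (ι s)) = ((1 / 2 : ℝ) : ℂ) • d := by
    simp [symRankOne, ← inner_conj_symm d, hdu]
  rw [h2, inner_zero_left, Complex.zero_re, add_zero, inner_smul_right,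
    inner_self_eq_norm_sq_to_K, Complex.re_ofReal_mul] at h1
  have h3 : d = 0 := by
    have : (1 / 2 : ℝ) * ‖d‖ ^ 2 = 0 := by
      rw [← h1]
      norm_cast
    simpa using this
  exact hinj (h3.trans (map_zero _).symm)

theorem IsWeaklyDense.form_eq_of_bracket_eq
    {V : Submodule ℝ (selfAdjoint (H →L[ℂ] H))} (hV : IsWeaklyDense V) (hι : IsWeaklySmooth E ι)
    {s : S} (hinj : Function.Injective (tangentLift E ι s)) (Ω Ω' : SymplecticForm E S)
    (h : ∀ A ∈ V, ∀ B ∈ V,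
      Ω'.bracket (fun s' => gelfand (A : H →L[ℂ] H) (ι s'))
        (fun s' => gelfand (B : H →L[ℂ] H) (ι s')) s
      = Ω.bracket (fun s' => gelfand (A : H →L[ℂ] H) (ι s'))
        (fun s' => gelfand (B : H →L[ℂ] H) (ι s')) s) :
    Ω'.form s = Ω.form s := by
  have hX : ∀ A ∈ V, Ω'.hamVF (fun s' => gelfand (A : H →L[ℂ] H) (ι s')) s
      = Ω.hamVF (fun s' => gelfand (A : H →L[ℂ] H) (ι s')) s := fun A hA => by
    refine sub_eq_zero.1 (hV.eq_zero_of_differential_eq_zero hι hinj fun B hB => ?_)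
    exact (map_sub (differential _ s) _ _).trans (sub_eq_zero.2 (h A hA B hB))
  refine ContinuousLinearMap.ext fun w => ?_
  -- Both forms have the same Hamiltonian vectors for V, so their difference, represented by `y`,
  -- vanishes on these; hence dÂ(y) = 0 for all A ∈ V.
  obtain ⟨y, hy⟩ := (Ω.nondegenerate s).surjective (Ω'.form s w - Ω.form s w)
  have hy0 : y = 0 := hV.eq_zero_of_differential_eq_zero hι hinj fun A hA => by
    have h1 := DFunLike.congr_fun hy (Ω.hamVF (fun s' => gelfand (A : H →L[ℂ] H) (ι s')) s)
    have h2 := Ω.form_hamVF (fun s' => gelfand (A : H →L[ℂ] H) (ι s')) s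
    have h3 := Ω'.form_hamVF (fun s' => gelfand (A : H →L[ℂ] H) (ι s')) s
    rw [hX A hA] at h3
    rw [← h2, Ω.form_swap]
    refine neg_eq_zero.2 (h1.trans ?_)
    rw [sub_apply, Ω.form_swap, Ω'.form_swap, h2, h3, sub_self]
  rw [hy0] at hy
  exact sub_eq_zero.1 (hy.symm.trans (map_zero (Ω.form s)))

variable [CompleteSpace E] {Ω : SymplecticForm E S}

theorem IsWeaklySmooth.exists_hamLift_eq_smul (hι : IsWeaklySmooth E ι) [TopologicalSpace (ℙ ℂ H)]
    {V : Submodule ℝ (selfAdjoint (H →L[ℂ] H))} (hV : IsWeaklyDense V)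
    (hP : IsSymplecticPoissonSpace Ω ι (gelfandSpace V)) (hU : IsUnitary Ω ι transProb) :
    ∃ c : ℝ, ∀ s w, inner ℂ (unitVec (ι s)) w = 0 → hamLift Ω ι s w = c • Complex.I • w := by
  let e := Equiv.ofBijective ι hP.bijective_leaf
  have he : ∀ ρ, ι (e.symm ρ) = ρ := e.apply_symm_apply
  -- Skewness moves K to the fixed vector, so that the identity becomes a WOT-continuous functional
  -- of A.
  have hadj : ∀ (s : S) (z x : H), (inner ℂ z (hamLift Ω ι s x)).re
      = (inner ℂ (-hamLift Ω ι s z) x).re := fun s z x => by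
    rw [hamLift_skew, inner_neg_left, Complex.neg_re, ← inner_conj_symm, Complex.conj_re]
  obtain ⟨c, hc⟩ := IsInfinitesimallyUnitary.exists_forall_eq_smul
    (k := fun ρ => (hamLift Ω ι (e.symm ρ) : H →ₗ[ℝ] H))
    (by
      intro A hA ρ σ
      simp only [ContinuousLinearMap.coe_coe, hadj]
      refine hV.re_inner_add_re_inner_eq_zero (fun B hB => ?_) hA
      have h := hι.re_add_re_eq_zero_of_isUnitary Ω hU B.2
        (hP.leafSmooth _ ⟨B, hB, rfl⟩) (e.symm ρ) (e.symm σ)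
      simpa only [he, hadj] using h)
    (fun ρ w => by
      have h := hι.inner_tangentLift (e.symm ρ) (hamVector Ω ι (e.symm ρ) w)
      rwa [he] at h)
    (fun ρ w w' => hamLift_skew Ω ι _ w w')
  refine ⟨c, fun s w hw => ?_⟩
  have h := hc (ι s) w hw
  rwa [show e.symm (ι s) = s from e.symm_apply_apply s] at h

theorem IsWeaklySmooth.bracket_gelfand_eq (hι : IsWeaklySmooth E ι) {c : ℝ}
    (hc : ∀ s w, inner ℂ (unitVec (ι s)) w = 0 → hamLift Ω ι s w = c • Complex.I • w)
    {A B : H →L[ℂ] H} (hA : IsSelfAdjoint A) (hB : IsSelfAdjoint B) (s : S) :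
    Ω.bracket (fun s' => gelfand A (ι s')) (fun s' => gelfand B (ι s')) s
      = -c * gelfand (iComm A B) (ι s) := by
  rw [hι.bracket_gelfand Ω hA hB, gelfand_eq]
  have hu := inner_unitVec_self (ι s)
  set u := unitVec (ι s) with hu_def
  have hsym : ∀ {T : H →L[ℂ] H}, IsSelfAdjoint T → ∀ x y, inner ℂ (T x) y = inner ℂ x (T y) :=
    fun hT x y => by rw [← adjoint_inner_left, hT.adjoint_eq]
  have h0 : hamLift Ω ι s (inner ℂ u (A u) • u) = 0 :=
    hamLift_eq_zero_of_inner_eq_zero Ω fun v => by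
      rw [inner_smul_left, hι.inner_tangentLift, mul_zero]
  have h1 : hamLift Ω ι s (A u) = c • Complex.I • (A u - inner ℂ u (A u) • u) := by
    rw [← hc s (A u - inner ℂ u (A u) • u)
      (by rw [inner_sub_right, inner_smul_right, hu, mul_one, sub_self]), map_sub, h0, sub_zero]
  have hreal : ∀ {T : H →L[ℂ] H}, IsSelfAdjoint T → (inner ℂ u (T u)).im = 0 := fun hT => by
    rw [← Complex.conj_eq_iff_im, inner_conj_symm, hsym hT]
  have h2 : (inner ℂ u (B (A u))).im = -(inner ℂ u (A (B u))).im := by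
    rw [← hsym hB, ← hsym hA u, ← inner_conj_symm (A u), Complex.conj_im, neg_neg]
  rw [h1, ← Complex.coe_smul, inner_smul_right, inner_smul_right, inner_sub_right,
    inner_smul_right, hsym hB, hsym hB]
  have h3 : (A * B - B * A) u = A (B u) - B (A u) := rfl
  simp only [iComm, smul_apply, h3, inner_smul_right, inner_sub_right,
    Complex.mul_re, Complex.sub_re, Complex.sub_im, Complex.mul_im, Complex.I_re, Complex.I_im,
    Complex.ofReal_re, Complex.ofReal_im, hreal hA, hreal hB, h2]
  ring

theorem IsWeaklySmooth.tangentLift_injective (hι : IsWeaklySmooth E ι) [TopologicalSpace (ℙ ℂ H)]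
    {V : Submodule ℝ (selfAdjoint (H →L[ℂ] H))}
    (hP : IsSymplecticPoissonSpace Ω ι (gelfandSpace V)) {c : ℝ}
    (hc : ∀ s w, inner ℂ (unitVec (ι s)) w = 0 → hamLift Ω ι s w = c • Complex.I • w) (s : S) :
    Function.Injective (tangentLift E ι s) := by
  have hinj := hP.bijective_leaf.injective
  rcases eq_or_ne c 0 with rfl | hne
  · have : Nonempty S := ⟨s⟩
    have : Subsingleton E := by
      refine subsingleton_of_differential_eq_zero (S := S)
        (𝔄 := {f | ∃ A ∈ V, f = fun s => gelfand (A : H →L[ℂ] H) (ι s)}) ?_ ?_ ?_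
      · intro s s' h
        by_contra hss
        obtain ⟨_, ⟨A, hA, rfl⟩, hf⟩ := hP.separates _ _ (hinj.ne hss)
        exact hf (h _ ⟨A, hA, rfl⟩)
      · rintro _ ⟨A, -, rfl⟩
        exact (hι _ A.2).mdifferentiable (by simp)
      · rintro _ ⟨A, -, rfl⟩ s v
        have h := hι.gelfand_hamVF_eq_zero hinj Ω A.2
          (fun B hB s => by rw [hι.bracket_gelfand_eq hc A.2 hB, neg_zero, zero_mul]) s
        rw [← Ω.form_hamVF, h]
        exact DFunLike.congr_fun (map_zero (Ω.form s)) v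
    exact Function.injective_of_subsingleton _
  · exact hι.tangentLift_injective_of_ne_zero hinj Ω hne (hc s)

/-- Since K(iLv) = -c Lv, injectivity of L shows that -c v represents the covector 2 Re⟨iLv, L·⟩ = 2
Im⟨Lv, L·⟩ with respect to Ω. -/
theorem IsWeaklySmooth.fubiniStudy_eq (hι : IsWeaklySmooth E ι) {c : ℝ}
    (hc : ∀ s w, inner ℂ (unitVec (ι s)) w = 0 → hamLift Ω ι s w = c • Complex.I • w) {s : S}
    (hinj : Function.Injective (tangentLift E ι s)) (v w : TangentSpace 𝓘(ℝ, E) s) :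
    fubiniStudy ι s v w = -c * Ω.form s v w := by
  have hu : inner ℂ (unitVec (ι s)) (tangentLift E ι s (v : E)) = 0 := hι.inner_tangentLift s v
  have hv : hamVector Ω ι s (Complex.I • tangentLift E ι s v) = (-c) • (v : E) := by
    apply hinj
    rw [← hamLift_apply, hc s _ (by rw [inner_smul_right]; exact mul_eq_zero_of_right _ hu),
      smul_smul Complex.I, Complex.I_mul_I, neg_one_smul, smul_neg, ← neg_smul]
    exact (map_smul (tangentLift E ι s) (-c) (v : E)).symm
  have h1 := form_hamVector Ω ι s (Complex.I • tangentLift E ι s v) w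
  rw [hv, inner_smul_left] at h1
  have h2 : Ω.form s ((-c) • v) w = -c * Ω.form s v w :=
    DFunLike.congr_fun (map_smul (Ω.form s) (-c) v) w
  have h3 : Ω.form s ((-c) • v) w
      = 2 * ((starRingEnd ℂ) Complex.I * inner ℂ (tangentLift E ι s v) (tangentLift E ι s w)).re :=
    h1
  have hne : ‖(ι s).rep‖ ≠ 0 := norm_ne_zero_iff.2 (ι s).rep_nonzero
  rw [← h2, h3, fubiniStudy, hι.horizontalLift_eq, hι.horizontalLift_eq, ← Complex.coe_smul,
    ← Complex.coe_smul, inner_smul_left, inner_smul_right, Complex.conj_ofReal,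
    Complex.im_ofReal_mul, Complex.im_ofReal_mul]
  simp only [Complex.conj_I, Complex.mul_re, Complex.neg_re, Complex.neg_im, Complex.I_re,
    Complex.I_im]
  field_simp
  ring

end Main

end PoissonTP

end

theorem mainTheorem7
    {H : Type*} [NormedAddCommGroup H] [InnerProductSpace ℂ H] [CompleteSpace H]
    [TopologicalSpace (ℙ ℂ H)]
    {E : Type*} [NormedAddCommGroup E] [NormedSpace ℝ E] [CompleteSpace E]
    {S : Type*} [TopologicalSpace S] [ChartedSpace E S] [IsManifold 𝓘(ℝ, E) ∞ S]
    (Ω : PoissonTP.SymplecticForm E S) (ι : S → ℙ ℂ H)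
    (hι : ∀ A : H →L[ℂ] H, IsSelfAdjoint A →
      ContMDiff 𝓘(ℝ, E) 𝓘(ℝ, ℝ) ∞ (fun s => PoissonTP.gelfand A (ι s)))
    (V : Submodule ℝ (selfAdjoint (H →L[ℂ] H)))
    (hV : PoissonTP.IsWeaklyDense V)
    (hP : PoissonTP.IsSymplecticPoissonSpace Ω ι (PoissonTP.gelfandSpace V))
    (hU : PoissonTP.IsUnitary Ω ι PoissonTP.transProb) :
    ∃ hbarInv : ℝ,
      (∀ A B : H →L[ℂ] H, IsSelfAdjoint A → IsSelfAdjoint B → ∀ s : S,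
        Ω.bracket (fun s' => PoissonTP.gelfand A (ι s')) (fun s' => PoissonTP.gelfand B (ι s')) s
          = hbarInv * PoissonTP.gelfand (PoissonTP.iComm A B) (ι s)) ∧
      (∀ (s : S) (v w : TangentSpace 𝓘(ℝ, E) s),
        PoissonTP.fubiniStudy ι s v w = hbarInv * Ω.form s v w) ∧
      (∀ Ω' : PoissonTP.SymplecticForm E S,
        (∀ A ∈ V, ∀ B ∈ V, ∀ s : S,
          Ω'.bracket (fun s' => PoissonTP.gelfand (A : H →L[ℂ] H) (ι s'))
              (fun s' => PoissonTP.gelfand (B : H →L[ℂ] H) (ι s')) s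
            = hbarInv * PoissonTP.gelfand
                (PoissonTP.iComm (A : H →L[ℂ] H) (B : H →L[ℂ] H)) (ι s)) →
        ∀ (s : S) (v w : TangentSpace 𝓘(ℝ, E) s), Ω'.form s v w = Ω.form s v w) := by
  obtain ⟨c, hc⟩ := PoissonTP.IsWeaklySmooth.exists_hamLift_eq_smul hι hV hP hU
  have hinj := PoissonTP.IsWeaklySmooth.tangentLift_injective hι hP hc
  refine ⟨-c, fun A B hA hB s => PoissonTP.IsWeaklySmooth.bracket_gelfand_eq hι hc hA hB s,
    fun s v w => PoissonTP.IsWeaklySmooth.fubiniStudy_eq hι hc (hinj s) v w,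
    fun Ω' hΩ' s v w => ?_⟩
  rw [hV.form_eq_of_bracket_eq hι (hinj s) Ω Ω' fun A hA B hB => by
    rw [hΩ' A hA B hB, PoissonTP.IsWeaklySmooth.bracket_gelfand_eq hι hc A.2 B.2]]
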